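/- **Setting.** Matrices have entries in $\mathbb R_+=[0,\infty)$ and are multiplied in max algebra: $(A\otimes B)_{ij}=\max_k a_{ik}b_{kj}$; all powers below are max-algebraic, with $A^0=I$. Let $A\in\mathbb R_+^{n\times n}$, $n\ge 1$. Its digraph $\mathcal D(A)$ has nodes $1,\dots,n$ and an edge $(i,j)$ whenever $a_{ij}\ne 0$. Node $i$ has access to node $j$ if there is a path, possibly of length $0$, from $i$ to $j$; the components of $\mathcal D(A)$ are the classes of mutual access (including trivial ones, whose only node lies on no cycle). The weight $w(P)$ of a cycle $P$ of length $k\ge1$ is the product of the entries along its edges; $\lambda(A)$ is the maximum of $w(P)^{1/k}$ over all cycles ($0$ if there are none), and the critical digraph consists of the nodes and edges of the cycles that attain it. The cyclicity of a strongly connected digraph is the g.c.d. of the lengths of its simple cycles; that of a disjoint union of strongly connected digraphs is the l.c.m. of the cyclicities of its components. Put $K_1=\{1,\dots,n\}$. Given $K_\mu$, let $A_\mu$ be $A$ with all entries outside $K_\mu\times K_\mu$ replaced by $0$, and $\lambda_\mu=\lambda(A_\mu)$. If $\lambda_\mu=0$, stop; otherwise let $(N_\mu,E_\mu)$ be the critical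 digraph of $A_\mu$, $\gamma_\mu$ its cyclicity, $M_\mu$ the union of the components of $\mathcal D(A)$ that meet $N_\mu$, and $K_{\mu+1}=K_\mu\setminus M_\mu$. Let $\Sigma$ be the set of those $\mu$ with $\lambda_\mu\neq0$ (so the $\lambda_\mu$, $\mu\in\Sigma$, are strictly decreasing), and $\gamma=\operatorname{lcm}_{\mu\in\Sigma}\gamma_\mu$ (equal to $1$ if $\Sigma=\emptyset$). For $\mu\in\Sigma$ let $B_\mu=\bigoplus_{s\ge0}\big((A_\mu/\lambda_\mu)^{\gamma_\mu}\big)^s$, where $\oplus$ is the entrywise maximum; let $C_\mu$ (respectively $R_\mu$) be $B_\mu$ with all columns (respectively rows) outside $N_\mu$ replaced by $0$, let $S_\mu$ be $A_\mu/\lambda_\mu$ with all entries outside $E_\mu$ replaced by $0$, and $U_\mu^{(1)}=C_\mu\otimes S_\mu\otimes R_\mu$. The matrix $A$ is *orbit periodic* if for every $y\in\mathbb R_+^n$ there is $\lambda(y)\in\mathbb R_+$ such that $A^{t+\gamma}\otimes y=\lambda(y)^{\gamma}\,(A^t\otimes y)$ for all sufficiently large $t$. **Theorem.** There are a single algorithm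 and a constant $\kappa$ such that the following holds for all $n\ge1$ and all $A\in\mathbb R_+^{n\times n}$. Suppose the algorithm is given $n$, $A$, the components of $\mathcal D(A)$ (the number of components and the component number of each node), the access relation between components (as a table of zeros and ones), the number of elements of $\Sigma$, and $\lambda_\mu$ and $U_\mu^{(1)}$ for all $\mu\in\Sigma$. Then it halts after at most $\kappa n^3$ operations, and its output is $1$ if $A$ is orbit periodic and $0$ otherwise. Here an algorithm is a finite program, independent of $n$ and of $A$, for a unit-cost random access machine with registers and arrays for natural numbers (constants, copying, increment, decrement, comparison, and use as array indices) and for nonnegative real numbers (constants $0$ and $1$, copying, maximum, product, comparison); every such elementary operation and every comparison counts as one operation. -/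

import Mathlib

open scoped NNReal

noncomputable section

/-! Max-times algebra of nonnegative matrices -/

namespace MaxAlg

/-- Square matrices with nonnegative real entries. -/
abbrev Mat (n : ℕ) := Matrix (Fin n) (Fin n) ℝ≥0

/-- The max-algebraic product: `(A ⊗ B) i j = max_k (A i k * B k j)`. -/
def mmul {n : ℕ} (A B : Mat n) : Mat n :=
  fun i j => Finset.univ.sup fun k => A i k * B k j

/-- The max-algebraic power, starting with the identity matrix. -/
def mpow {n : ℕ} (A : Mat n) : ℕ → Mat n
  | 0 => 1
  | t + 1 => mmul (mpow A t) A

/-- The max-algebraic matrix-vector product. -/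
def mvec {n : ℕ} (A : Mat n) (y : Fin n → ℝ≥0) : Fin n → ℝ≥0 :=
  fun i => Finset.univ.sup fun k => A i k * y k

/-- The Kleene star `I ⊕ A ⊕ A² ⊕ ⋯` (meaningful when the series is bounded, that is, when the
maximum cycle geometric mean of `A` is at most one; it is only used in that case). -/
def star {n : ℕ} (A : Mat n) : Mat n :=
  fun i j => ⨆ t : ℕ, mpow A t i j

/-! Digraphs on the nodes `Fin n`, given by their edge relation -/

/-- `(c 0, c 1, …, c k)` with `c k = c 0` is a cycle of length `k ≥ 1` in the digraph `E`. -/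
def IsCycle {n : ℕ} (E : Fin n → Fin n → Prop) (k : ℕ) (c : ℕ → Fin n) : Prop :=
  0 < k ∧ c k = c 0 ∧ ∀ t < k, E (c t) (c (t + 1))

/-- A cycle is simple if it does not repeat a node (apart from its end point). -/
def IsSimpleCycle {n : ℕ} (E : Fin n → Fin n → Prop) (k : ℕ) (c : ℕ → Fin n) : Prop :=
  IsCycle E k c ∧ Set.InjOn c (Set.Iio k)

/-- `i` has access to `j`: there is a path (possibly of length zero) from `i` to `j`. -/
def Access {n : ℕ} (E : Fin n → Fin n → Prop) (i j : Fin n) : Prop :=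
  Relation.ReflTransGen E i j

/-- `i` and `j` lie in the same component of the digraph. -/
def SameComp {n : ℕ} (E : Fin n → Fin n → Prop) (i j : Fin n) : Prop :=
  Access E i j ∧ Access E j i

/-- `i` is an end point of an edge of `E`. -/
def IsNode {n : ℕ} (E : Fin n → Fin n → Prop) (i : Fin n) : Prop :=
  ∃ j, E i j ∨ E j i

open Classical in
/-- The cyclicity of the component of `i` in `E`: the g.c.d. of the lengths of its simple cycles
(a simple cycle has length at most `n`). -/
def compCyclicity {n : ℕ} (E : Fin n → Fin n → Prop) (i : Fin n) : ℕ :=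
  ((Finset.Icc 1 n).filter fun k => ∃ c, IsSimpleCycle E k c ∧ SameComp E (c 0) i).gcd id

open Classical in
/-- The cyclicity of a digraph consisting of disjoint strongly connected components: the l.c.m. of
the cyclicities of the components. -/
def cyclicity {n : ℕ} (E : Fin n → Fin n → Prop) : ℕ :=
  (Finset.univ.filter fun i => IsNode E i).lcm fun i => compCyclicity E i

/-! The digraph of a matrix, its maximum cycle geometric mean and its critical digraph -/

/-- The edges of the digraph associated with `A`. -/
def Edge {n : ℕ} (A : Mat n) (i j : Fin n) : Prop := A i j ≠ 0

/-- The weight of the path `(c 0, …, c k)`. -/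
def weight {n : ℕ} (A : Mat n) (k : ℕ) (c : ℕ → Fin n) : ℝ≥0 :=
  ∏ t ∈ Finset.range k, A (c t) (c (t + 1))

/-- The geometric mean `w(P)^(1/k)` of the cycle `P = (c 0, …, c k)`. -/
def cycleMean {n : ℕ} (A : Mat n) (k : ℕ) (c : ℕ → Fin n) : ℝ≥0 :=
  weight A k c ^ (1 / (k : ℝ))

/-- The maximum cycle geometric mean of `A`, taken over the cycles of length at most `n`;
it is `0` if there is no cycle. -/
def mcgm {n : ℕ} (A : Mat n) : ℝ≥0 :=
  sSup {x | ∃ k c, k ≤ n ∧ IsCycle (Edge A) k c ∧ x = cycleMean A k c}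

/-- The edges of the critical digraph: those lying on a cycle whose geometric mean is maximal. -/
def CritEdge {n : ℕ} (A : Mat n) (i j : Fin n) : Prop :=
  ∃ k c, IsCycle (Edge A) k c ∧ cycleMean A k c = mcgm A ∧ ∃ t < k, c t = i ∧ c (t + 1) = j

/-! `CSR` products -/

/-- Entrywise division by a scalar. -/
def scale {n : ℕ} (A : Mat n) (l : ℝ≥0) : Mat n := fun i j => A i j / l

/-- The star `(A ^ γ)*`, where `γ` is the cyclicity of the digraph `E`. -/
def csrB {n : ℕ} (A : Mat n) (E : Fin n → Fin n → Prop) : Mat n :=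
  star (mpow A (cyclicity E))

open Classical in
/-- The columns of `csrB` at nodes of `E`, zero elsewhere. -/
def csrC {n : ℕ} (A : Mat n) (E : Fin n → Fin n → Prop) : Mat n :=
  fun i j => if IsNode E j then csrB A E i j else 0

open Classical in
/-- The rows of `csrB` at nodes of `E`, zero elsewhere. -/
def csrR {n : ℕ} (A : Mat n) (E : Fin n → Fin n → Prop) : Mat n :=
  fun i j => if IsNode E i then csrB A E i j else 0

open Classical in
/-- The entries of `A` on the edges of `E`, zero elsewhere. -/
def csrS {n : ℕ} (A : Mat n) (E : Fin n → Fin n → Prop) : Mat n :=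
  fun i j => if E i j then A i j else 0

/-- The product `C ⊗ S ^ t ⊗ R`. -/
def csr {n : ℕ} (A : Mat n) (E : Fin n → Fin n → Prop) (t : ℕ) : Mat n :=
  mmul (mmul (csrC A E) (mpow (csrS A E) t)) (csrR A E)

/-! The ultimate expansion. Its terms are numbered `0, 1, …, ultCount A - 1`, by strictly
decreasing values of `ultLambda`. -/

open Classical in
/-- `A` with all entries outside of `K × K` replaced by zero. -/
def restrict {n : ℕ} (A : Mat n) (K : Set (Fin n)) : Mat n :=
  fun i j => if i ∈ K ∧ j ∈ K then A i j else 0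

/-- The nodes that remain after `μ` steps: each step removes all components of the digraph of `A`
that contain a critical node of the current restriction of `A`. -/
def ultK {n : ℕ} (A : Mat n) : ℕ → Set (Fin n)
  | 0 => Set.univ
  | μ + 1 => ultK A μ \
      {i | ∃ k, IsNode (CritEdge (restrict A (ultK A μ))) k ∧ SameComp (Edge A) i k}

/-- The restriction `A_μ` of `A` to the remaining nodes. -/
def ultA {n : ℕ} (A : Mat n) (μ : ℕ) : Mat n := restrict A (ultK A μ)

/-- The value `λ_μ`. -/
def ultLambda {n : ℕ} (A : Mat n) (μ : ℕ) : ℝ≥0 := mcgm (ultA A μ)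

/-- The number of terms: the construction ends at the first `μ` with `λ_μ = 0`. -/
def ultCount {n : ℕ} (A : Mat n) : ℕ := sInf {μ | ultLambda A μ = 0}

/-- The matrix `U_μ^(t)`. -/
def ultU {n : ℕ} (A : Mat n) (μ t : ℕ) : Mat n :=
  csr (scale (ultA A μ) (ultLambda A μ)) (CritEdge (ultA A μ)) t

/-- The l.c.m. of the cyclicities of the critical digraphs of all terms. -/
def ultGamma {n : ℕ} (A : Mat n) : ℕ :=
  (Finset.range (ultCount A)).lcm fun μ => cyclicity (CritEdge (ultA A μ))

/-- Orbit periodicity: every orbit `A ^ t ⊗ y` is ultimately linear periodic. -/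
def OrbitPeriodic {n : ℕ} (A : Mat n) : Prop :=
  ∀ y : Fin n → ℝ≥0, ∃ l : ℝ≥0, ∀ᶠ t in Filter.atTop,
    mvec (mpow A (t + ultGamma A)) y = l ^ ultGamma A • mvec (mpow A t) y

/-- `comp` numbers the components of the digraph of `A` (trivial ones included) by
`0, …, c - 1`. -/
def IsComponentNumbering {n c : ℕ} (A : Mat n) (comp : Fin n → Fin c) : Prop :=
  Function.Surjective comp ∧ ∀ i j, comp i = comp j ↔ SameComp (Edge A) i j

end MaxAlg

/-! A random access machine with unit costs. It works on natural numbers, used as indices and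
truth values, which can only be copied, compared, incremented and decremented, and on nonnegative
real numbers, with the operations of max algebra and comparisons. -/

namespace RAM

/-- Memory: registers for natural and for real numbers, two-dimensional arrays of natural
numbers, and three-dimensional arrays of real numbers. The first argument of `iarr` and `rarr` is
the number of the array. -/
structure State where
  ireg : ℕ → ℕ
  rreg : ℕ → ℝ≥0
  iarr : ℕ → ℕ → ℕ → ℕ
  rarr : ℕ → ℕ → ℕ → ℕ → ℝ≥0

/-- Elementary operations. Arguments are numbers of registers, except for the literal in `constI`
and for the number `a` of an array in the load and store operations. -/
inductive Op where
  | constI (r v : ℕ)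
  | copyI (r s : ℕ)
  | succI (r : ℕ)
  | predI (r : ℕ)
  | loadI (r a p q : ℕ)
  | storeI (a p q r : ℕ)
  | zeroR (x : ℕ)
  | oneR (x : ℕ)
  | copyR (x y : ℕ)
  | maxR (x y z : ℕ)
  | mulR (x y z : ℕ)
  | loadR (x a p q r : ℕ)
  | storeR (a p q r x : ℕ)

/-- Assignment to a register for natural numbers. -/
def State.setI (s : State) (r v : ℕ) : State :=
  { s with ireg := Function.update s.ireg r v }

/-- Assignment to a register for real numbers. -/
def State.setR (s : State) (x : ℕ) (v : ℝ≥0) : State :=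
  { s with rreg := Function.update s.rreg x v }

/-- The effect of an elementary operation. -/
def Op.run : Op → State → State
  | .constI r v, s => s.setI r v
  | .copyI r r', s => s.setI r (s.ireg r')
  | .succI r, s => s.setI r (s.ireg r + 1)
  | .predI r, s => s.setI r (s.ireg r - 1)
  | .loadI r a p q, s => s.setI r (s.iarr a (s.ireg p) (s.ireg q))
  | .storeI a p q r, s =>
      { s with iarr := fun b i j =>
          if b = a ∧ i = s.ireg p ∧ j = s.ireg q then s.ireg r else s.iarr b i j }
  | .zeroR x, s => s.setR x 0
  | .oneR x, s => s.setR x 1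
  | .copyR x y, s => s.setR x (s.rreg y)
  | .maxR x y z, s => s.setR x (max (s.rreg y) (s.rreg z))
  | .mulR x y z, s => s.setR x (s.rreg y * s.rreg z)
  | .loadR x a p q r, s => s.setR x (s.rarr a (s.ireg p) (s.ireg q) (s.ireg r))
  | .storeR a p q r x, s =>
      { s with rarr := fun b i j k =>
          if b = a ∧ i = s.ireg p ∧ j = s.ireg q ∧ k = s.ireg r then s.rreg x
          else s.rarr b i j k }

/-- Comparisons of the contents of two registers. -/
inductive Test where
  | ltI (r s : ℕ)
  | eqI (r s : ℕ)
  | ltR (x y : ℕ)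
  | eqR (x y : ℕ)

/-- The outcome of a comparison. -/
def Test.Holds : Test → State → Prop
  | .ltI r r', s => s.ireg r < s.ireg r'
  | .eqI r r', s => s.ireg r = s.ireg r'
  | .ltR x y, s => s.rreg x < s.rreg y
  | .eqR x y, s => s.rreg x = s.rreg y

/-- Programs. A program is a finite text, the same for all inputs of all sizes. -/
inductive Prog where
  | skip
  | op (o : Op)
  | seq (p q : Prog)
  | ite (b : Test) (p q : Prog)
  | loop (b : Test) (p : Prog)

/-- `Exec p s s' T`: started in the state `s`, the program `p` halts in the state `s'` after
exactly `T` steps, where each elementary operation and each comparison is one step. -/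
inductive Exec : Prog → State → State → ℕ → Prop where
  | skip (s : State) : Exec .skip s s 1
  | op (o : Op) (s : State) : Exec (.op o) s (o.run s) 1
  | seq {p q : Prog} {s s' s'' : State} {T T' : ℕ} :
      Exec p s s' T → Exec q s' s'' T' → Exec (.seq p q) s s'' (T + T')
  | ite_true {b : Test} {p q : Prog} {s s' : State} {T : ℕ} :
      b.Holds s → Exec p s s' T → Exec (.ite b p q) s s' (T + 1)
  | ite_false {b : Test} {p q : Prog} {s s' : State} {T : ℕ} :
      ¬ b.Holds s → Exec q s s' T → Exec (.ite b p q) s s' (T + 1)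
  | loop_done {b : Test} {p : Prog} {s : State} :
      ¬ b.Holds s → Exec (.loop b p) s s 1
  | loop_step {b : Test} {p : Prog} {s s' s'' : State} {T T' : ℕ} :
      b.Holds s → Exec p s s' T → Exec (.loop b p) s' s'' T' → Exec (.loop b p) s s'' (T + T' + 1)

/-- The machine is deterministic. -/
theorem Exec.unique {p : Prog} {s s₁ s₂ : State} {T₁ T₂ : ℕ}
    (h₁ : Exec p s s₁ T₁) (h₂ : Exec p s s₂ T₂) : s₁ = s₂ ∧ T₁ = T₂ := by
  induction h₁ generalizing s₂ T₂ with
  | skip s => cases h₂; exact ⟨rfl, rfl⟩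
  | op o s => cases h₂; exact ⟨rfl, rfl⟩
  | seq _ _ ih ih' =>
    cases h₂ with
    | seq k k' =>
      obtain ⟨rfl, rfl⟩ := ih k
      obtain ⟨rfl, rfl⟩ := ih' k'
      exact ⟨rfl, rfl⟩
  | ite_true hb _ ih =>
    cases h₂ with
    | ite_true _ k => obtain ⟨rfl, rfl⟩ := ih k; exact ⟨rfl, rfl⟩
    | ite_false hb' _ => exact absurd hb hb'
  | ite_false hb _ ih =>
    cases h₂ with
    | ite_true hb' _ => exact absurd hb' hb
    | ite_false _ k => obtain ⟨rfl, rfl⟩ := ih k; exact ⟨rfl, rfl⟩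
  | loop_done hb =>
    cases h₂ with
    | loop_done _ => exact ⟨rfl, rfl⟩
    | loop_step hb' _ _ => exact absurd hb' hb
  | loop_step hb _ _ ih ih' =>
    cases h₂ with
    | loop_done hb' => exact absurd hb hb'
    | loop_step _ k k' =>
      obtain ⟨rfl, rfl⟩ := ih k
      obtain ⟨rfl, rfl⟩ := ih' k'
      exact ⟨rfl, rfl⟩

end RAM

namespace MaxAlg

open Classical in
/-- The initial memory. Index registers `0, 1, 2` hold `n`, the number of components, and the
number of terms of the ultimate expansion. Array `0` of natural numbers holds the component of
each node, array `1` the access relation between components as a table of zeros and ones. Array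
`0` of real numbers holds `A`, array `1` the values `λ_μ`, and array `2` the matrices `U_μ^(1)`.
Everything else is zero. -/
def input {n c : ℕ} (A : Mat n) (comp : Fin n → Fin c) : RAM.State where
  ireg r :=
    if r = 0 then n else if r = 1 then c else if r = 2 then ultCount A else 0
  rreg _ := 0
  iarr a p q :=
    if a = 0 then (if h : p < n ∧ q = 0 then (comp ⟨p, h.1⟩ : ℕ) else 0)
    else if a = 1 then
      (if ∃ i j, (comp i : ℕ) = p ∧ (comp j : ℕ) = q ∧ Access (Edge A) i j then 1 else 0)
    else 0
  rarr a p q r :=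
    if a = 0 then (if h : p = 0 ∧ q < n ∧ r < n then A ⟨q, h.2.1⟩ ⟨r, h.2.2⟩ else 0)
    else if a = 1 then (if p < ultCount A ∧ q = 0 ∧ r = 0 then ultLambda A p else 0)
    else if a = 2 then
      (if h : p < ultCount A ∧ q < n ∧ r < n then ultU A p 1 ⟨q, h.2.1⟩ ⟨r, h.2.2⟩ else 0)
    else 0

end MaxAlg

end

namespace MaxAlg

variable {n : ℕ}

/-! Powers in max algebra and walks -/

/-! Entries of max-algebraic powers are maximal weights of walks. Fix `i`, `j` and a residue `r`
modulo `ultGamma A`, and let `lead A i j r` be the first term of the expansion with a critical node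
on some walk from `i` to `j` of length congruent to `r`. If such a walk met a component removed
before that term, a detour to a critical node of the component, repeated `ultGamma A` times, would
keep the residue and contradict minimality (`mem_ultK_of_walk`). So these walks live in the
restricted matrix of the leading term, and `eventually_mpow_eq` shows that the entry is ultimately a
nonzero constant times the power of the leading `ultLambda`; with no leading term it ultimately
vanishes.

Hence entry `i` of an orbit grows along `r` at the rate of the least lead over the support of `y`,
and orbit periodicity says that all rates occurring for one `y` agree. Vectors supported on at most
two nodes already detect a disagreement. Residue `1` suffices, because a row can be exchanged for
one further along or further back on a critical walk (`exists_shift`). This gives the criterion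
`orbitPeriodic_iff` on the numbers `lead A i j 1`.

These numbers can be read off the supports of the matrices `ultU A ν 1` (`lead_one_eq`): extra
critical loops turn a length condition modulo the cyclicity of one term into one modulo `ultGamma
A`. The criterion quantifies over four indices, but one row index enters only through the minimum of
a column (`orbitPeriodic_iff_leadNum`). Tabulating leads and column minima and then searching over
triples takes cubic time, since there are at most `n` terms (`ultCount_le`). -/

theorem mul_le_mmul (A B : Mat n) (i k j : Fin n) : A i k * B k j ≤ mmul A B i j :=
  Finset.le_sup (f := fun k => A i k * B k j) (Finset.mem_univ k)

theorem exists_mmul_eq (A B : Mat n) (i j : Fin n) : ∃ k, mmul A B i j = A i k * B k j := by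
  obtain ⟨k, -, hk⟩ := Finset.exists_mem_eq_sup Finset.univ ⟨i, Finset.mem_univ i⟩
    (fun k => A i k * B k j)
  exact ⟨k, hk⟩

theorem mmul_ne_zero_iff (A B : Mat n) (i j : Fin n) :
    mmul A B i j ≠ 0 ↔ ∃ k, A i k ≠ 0 ∧ B k j ≠ 0 := by
  constructor
  · intro h
    obtain ⟨k, hk⟩ := exists_mmul_eq A B i j
    rw [hk] at h
    exact ⟨k, left_ne_zero_of_mul h, right_ne_zero_of_mul h⟩
  · rintro ⟨k, h₁, h₂⟩ h
    have := mul_le_mmul A B i k j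
    rw [h] at this
    exact mul_ne_zero h₁ h₂ (le_antisymm this (zero_le))

@[simp] theorem mpow_zero_self (A : Mat n) (i : Fin n) : mpow A 0 i i = 1 :=
  Matrix.one_apply_eq i

theorem mpow_zero_ne_zero {A : Mat n} {i j : Fin n} (h : mpow A 0 i j ≠ 0) : i = j := by
  by_contra hij
  exact h (Matrix.one_apply_ne hij)

theorem mpow_one (A : Mat n) (i j : Fin n) : mpow A 1 i j = A i j := by
  apply le_antisymm
  · obtain ⟨k, hk⟩ := exists_mmul_eq (mpow A 0) A i j
    change mmul (mpow A 0) A i j ≤ _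
    rw [hk]
    by_cases hik : i = k
    · subst hik; simp
    · simp [mpow, Matrix.one_apply_ne hik]
  · have := mul_le_mmul (mpow A 0) A i i j
    rwa [mpow_zero_self, one_mul] at this

theorem mpow_mul_le (A : Mat n) (a b : ℕ) (i k j : Fin n) :
    mpow A a i k * mpow A b k j ≤ mpow A (a + b) i j := by
  induction b generalizing j with
  | zero =>
    by_cases hkj : k = j
    · subst hkj; simp
    · simp [mpow, Matrix.one_apply_ne hkj]
  | succ b ih =>
    obtain ⟨l, hl⟩ := exists_mmul_eq (mpow A b) A k j
    change _ * mmul (mpow A b) A k j ≤ mmul (mpow A (a + b)) A i j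
    rw [hl, ← mul_assoc]
    exact (mul_le_mul_left (ih l) _).trans (mul_le_mmul _ _ _ _ _)

theorem mpow_add_ne_zero {A : Mat n} {a b : ℕ} {i k j : Fin n} (h₁ : mpow A a i k ≠ 0)
    (h₂ : mpow A b k j ≠ 0) : mpow A (a + b) i j ≠ 0 := by
  intro h
  have := mpow_mul_le A a b i k j
  rw [h] at this
  exact mul_ne_zero h₁ h₂ (le_antisymm this (zero_le))

theorem mpow_mul_ne_zero {A : Mat n} {a : ℕ} {i : Fin n} (h : mpow A a i i ≠ 0) (m : ℕ) :
    mpow A (m * a) i i ≠ 0 := by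
  induction m with
  | zero => simp
  | succ m ih => rw [Nat.succ_mul]; exact mpow_add_ne_zero ih h

theorem mpow_mono {A B : Mat n} (h : ∀ i j, A i j ≤ B i j) (t : ℕ) (i j : Fin n) :
    mpow A t i j ≤ mpow B t i j := by
  induction t generalizing j with
  | zero => exact le_rfl
  | succ t ih =>
    obtain ⟨l, hl⟩ := exists_mmul_eq (mpow A t) A i j
    change mmul (mpow A t) A i j ≤ mmul (mpow B t) B i j
    rw [hl]
    exact (mul_le_mul' (ih l) (h l j)).trans (mul_le_mmul _ _ _ _ _)

theorem ne_zero_of_le {a b : ℝ≥0} (h : a ≤ b) (ha : a ≠ 0) : b ≠ 0 :=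
  fun hb => ha (le_antisymm (hb ▸ h) (zero_le))

theorem weight_succ (A : Mat n) (t : ℕ) (c : ℕ → Fin n) :
    weight A (t + 1) c = weight A t c * A (c t) (c (t + 1)) :=
  Finset.prod_range_succ _ _

theorem weight_add (A : Mat n) (a b : ℕ) (c : ℕ → Fin n) :
    weight A (a + b) c = weight A a c * weight A b (fun s => c (a + s)) :=
  Finset.prod_range_add _ _ _

theorem weight_congr {A B : Mat n} {t : ℕ} {c c' : ℕ → Fin n}
    (h : ∀ s < t, A (c s) (c (s + 1)) = B (c' s) (c' (s + 1))) : weight A t c = weight B t c' :=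
  Finset.prod_congr rfl fun s hs => h s (Finset.mem_range.1 hs)

theorem weight_le_mpow (A : Mat n) (t : ℕ) (c : ℕ → Fin n) :
    weight A t c ≤ mpow A t (c 0) (c t) := by
  induction t with
  | zero => simp [weight]
  | succ t ih =>
    rw [weight_succ]
    exact (mul_le_mul_left ih _).trans (mul_le_mmul _ _ _ _ _)

theorem weight_le_mul (A : Mat n) {t s : ℕ} (hs : s ≤ t) (c : ℕ → Fin n) :
    weight A t c ≤ mpow A s (c 0) (c s) * mpow A (t - s) (c s) (c t) := by
  obtain ⟨b, rfl⟩ := Nat.exists_eq_add_of_le hs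
  rw [weight_add, Nat.add_sub_cancel_left]
  exact mul_le_mul' (weight_le_mpow _ _ _) (weight_le_mpow A b fun u => c (s + u))

theorem exists_weight_eq {A : Mat n} {t : ℕ} {i j : Fin n} (h : mpow A t i j ≠ 0) :
    ∃ c : ℕ → Fin n, c 0 = i ∧ c t = j ∧ weight A t c = mpow A t i j := by
  induction t generalizing j with
  | zero =>
    obtain rfl := mpow_zero_ne_zero h
    exact ⟨fun _ => i, rfl, rfl, by simp [weight]⟩
  | succ t ih =>
    obtain ⟨l, hl⟩ := exists_mmul_eq (mpow A t) A i j
    change mmul (mpow A t) A i j ≠ 0 at h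
    rw [hl] at h
    obtain ⟨c, h0, ht, hw⟩ := ih (left_ne_zero_of_mul h)
    refine ⟨fun s => if s ≤ t then c s else j, by simpa using h0, by simp, ?_⟩
    change _ = mmul (mpow A t) A i j
    rw [weight_succ, hl, ← hw]
    have : weight A t (fun s => if s ≤ t then c s else j) = weight A t c :=
      weight_congr fun s hs => by simp [hs.le, Nat.succ_le_of_lt hs]
    rw [this]
    simp [ht]

theorem edge_of_weight_ne_zero {A : Mat n} {t : ℕ} {c : ℕ → Fin n} (h : weight A t c ≠ 0)
    {s : ℕ} (hs : s < t) : A (c s) (c (s + 1)) ≠ 0 :=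
  Finset.prod_ne_zero_iff.1 h s (Finset.mem_range.2 hs)

theorem weight_ne_zero {A : Mat n} {t : ℕ} {c : ℕ → Fin n}
    (h : ∀ s < t, A (c s) (c (s + 1)) ≠ 0) : weight A t c ≠ 0 :=
  Finset.prod_ne_zero_iff.2 fun s hs => h s (Finset.mem_range.1 hs)

theorem access_iff (A : Mat n) (i j : Fin n) : Access (Edge A) i j ↔ ∃ t, mpow A t i j ≠ 0 := by
  constructor
  · intro h
    induction h with
    | refl => exact ⟨0, by simp⟩
    | tail _ he ih =>
      obtain ⟨t, ht⟩ := ih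
      exact ⟨t + 1, (mmul_ne_zero_iff _ _ _ _).2 ⟨_, ht, he⟩⟩
  · rintro ⟨t, ht⟩
    induction t generalizing j with
    | zero => rw [mpow_zero_ne_zero ht]; exact Relation.ReflTransGen.refl
    | succ t ih =>
      obtain ⟨k, h₁, h₂⟩ := (mmul_ne_zero_iff _ _ _ _).1 ht
      exact (ih k h₁).tail h₂

/-- A long walk contains a closed walk whose length is a multiple of `d`. -/
theorem mpow_cut {A : Mat n} {d t : ℕ} (hd : 0 < d) (ht : n * d ≤ t) {i j : Fin n}
    (h : mpow A t i j ≠ 0) :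
    ∃ a b e p, a + b + e = t ∧ 0 < b ∧ b ≤ n * d ∧ d ∣ b ∧
      mpow A t i j ≤ mpow A a i p * mpow A b p p * mpow A e p j := by
  obtain ⟨c, rfl, rfl, hw⟩ := exists_weight_eq h
  -- Pigeonhole on pairs (node, position modulo `d`): a node recurs after a number of steps
  -- divisible by `d`.
  have : ∃ x y : Fin (n * d + 1), x ≠ y ∧
      (fun s : Fin (n * d + 1) => (c s, (⟨s % d, Nat.mod_lt _ hd⟩ : Fin d))) x =
      (fun s : Fin (n * d + 1) => (c s, (⟨s % d, Nat.mod_lt _ hd⟩ : Fin d))) y :=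
    Fintype.exists_ne_map_eq_of_card_lt _ (by simp)
  obtain ⟨x, y, hxy, he⟩ := this
  wlog hlt : x < y generalizing x y
  · exact this y x hxy.symm he.symm (lt_of_le_of_ne (not_lt.1 hlt) hxy.symm)
  simp only [Prod.mk.injEq, Fin.mk.injEq] at he
  obtain ⟨hc, hm⟩ := he
  have hlt' : (x : ℕ) < y := hlt
  have hy : (y : ℕ) ≤ n * d := Nat.lt_succ_iff.1 y.2
  refine ⟨x, y - x, t - y, c x, by omega, by omega, by omega, ?_, ?_⟩
  · exact (Nat.modEq_iff_dvd' hlt'.le).1 hm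
  · rw [← hw]
    have h₁ : t = x + ((y - x) + (t - y)) := by omega
    have h₂ : ((x : ℕ) + (y - x)) = y := by omega
    have h₃ : (x : ℕ) + ((y - x) + (t - y)) = t := by omega
    have e₁ := weight_le_mpow A x c
    have e₂ := weight_le_mpow A (y - x) (fun s => c (x + s))
    have e₃ := weight_le_mpow A (t - y) (fun s => c (x + ((y - x) + s)))
    simp only [Nat.add_zero, h₂, h₃, ← hc] at e₁ e₂ e₃
    conv_lhs => rw [h₁, weight_add, weight_add]
    rw [mul_assoc]
    exact mul_le_mul' e₁ (mul_le_mul' e₂ e₃)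

/-! The maximum cycle geometric mean -/

/-- A cycle mean depends only on the length and the first `n + 1` nodes. Finiteness makes the
supremum in `mcgm` a genuine, attained maximum whenever there is a cycle. -/
theorem finite_cycleMeans (A : Mat n) :
    {x | ∃ k c, k ≤ n ∧ IsCycle (Edge A) k c ∧ x = cycleMean A k c}.Finite := by
  apply (Set.finite_range fun q : Fin (n + 1) × (Fin (n + 1) → Fin n) =>
    cycleMean A q.1 (fun s => q.2 ⟨min s n, by omega⟩)).subset
  rintro x ⟨k, c, hk, -, rfl⟩
  refine ⟨(⟨k, by omega⟩, fun s => c s), ?_⟩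
  refine congrArg (· ^ (1 / (k : ℝ))) (weight_congr fun s hs => ?_)
  have hs' : s < k := hs
  have h₁ : min s n = s := min_eq_left (by omega)
  have h₂ : min (s + 1) n = s + 1 := min_eq_left (by omega)
  simp only [h₁, h₂]

theorem cycleMean_pow (A : Mat n) {k : ℕ} (hk : 0 < k) (c : ℕ → Fin n) :
    cycleMean A k c ^ k = weight A k c := by
  rw [cycleMean, ← NNReal.rpow_natCast, ← NNReal.rpow_mul, one_div,
    inv_mul_cancel₀ (Nat.cast_ne_zero.2 hk.ne'), NNReal.rpow_one]

theorem cycleMean_eq_iff (A : Mat n) {k : ℕ} (hk : 0 < k) (c : ℕ → Fin n) (x : ℝ≥0) :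
    cycleMean A k c = x ↔ weight A k c = x ^ k := by
  rw [← cycleMean_pow A hk]
  exact (pow_left_inj₀ (zero_le) (zero_le) hk.ne').symm

theorem mpow_diag_le_of_le (A : Mat n) {k : ℕ} (hk : 0 < k) (hkn : k ≤ n) (i : Fin n) :
    mpow A k i i ≤ mcgm A ^ k := by
  by_cases h : mpow A k i i = 0
  · rw [h]; exact zero_le
  obtain ⟨c, h0, hc, hw⟩ := exists_weight_eq h
  rw [← hw, ← cycleMean_pow A hk]
  apply pow_le_pow_left₀ (zero_le)
  refine le_csSup (finite_cycleMeans A).bddAbove ⟨k, c, hkn, ⟨hk, hc.trans h0.symm, ?_⟩, rfl⟩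
  intro t ht
  exact edge_of_weight_ne_zero (by rw [hw]; exact h) ht

/-- The bound built into `mcgm` covers lengths up to `n` only. A longer closed walk splits at a
repeated node `p` into a short closed walk and a shorter closed walk, the latter rotated so as to
start at `p`. -/
theorem mpow_diag_le (A : Mat n) (k : ℕ) (i : Fin n) : mpow A k i i ≤ mcgm A ^ k := by
  induction k using Nat.strong_induction_on generalizing i with
  | _ k ih =>
    rcases Nat.eq_zero_or_pos k with rfl | hk
    · simp
    rcases le_or_gt k n with hkn | hkn
    · exact mpow_diag_le_of_le A hk hkn i
    by_cases h : mpow A k i i = 0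
    · rw [h]; exact zero_le
    obtain ⟨a, b, e, p, habe, hb, hbn, -, hle⟩ :=
      mpow_cut (d := 1) one_pos (by omega) h
    rw [Nat.mul_one] at hbn
    calc mpow A k i i ≤ mpow A a i p * mpow A b p p * mpow A e p i := hle
      _ = mpow A b p p * (mpow A e p i * mpow A a i p) := by ring
      _ ≤ mcgm A ^ b * mcgm A ^ (e + a) :=
        mul_le_mul' (mpow_diag_le_of_le A hb hbn p)
          ((mpow_mul_le A e a p i p).trans (ih _ (by omega) p))
      _ = mcgm A ^ k := by rw [← pow_add]; congr 1; omega

theorem exists_mpow_diag_eq {A : Mat n} (h : mcgm A ≠ 0) :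
    ∃ k i, 0 < k ∧ mpow A k i i = mcgm A ^ k := by
  have hne : {x | ∃ k c, k ≤ n ∧ IsCycle (Edge A) k c ∧ x = cycleMean A k c}.Nonempty := by
    by_contra hne
    rw [Set.not_nonempty_iff_eq_empty] at hne
    apply h
    rw [mcgm, hne, csSup_empty]
    rfl
  obtain ⟨k, c, -, hc, hx⟩ := hne.csSup_mem (finite_cycleMeans A)
  refine ⟨k, c 0, hc.1, le_antisymm (mpow_diag_le A k _) ?_⟩
  rw [show mcgm A = cycleMean A k c from hx, cycleMean_pow A hc.1]
  have := weight_le_mpow A k c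
  rwa [hc.2.1] at this

theorem mcgm_mono {A B : Mat n} (h : ∀ i j, A i j ≤ B i j) : mcgm A ≤ mcgm B := by
  by_cases h0 : mcgm A = 0
  · rw [h0]; exact zero_le
  obtain ⟨k, i, hk, hki⟩ := exists_mpow_diag_eq h0
  have := (mpow_mono h k i i).trans (mpow_diag_le B k i)
  rw [hki] at this
  exact (pow_le_pow_iff_left₀ (zero_le) (zero_le) hk.ne').1 this

theorem mpow_eq_zero_of_mcgm_eq_zero {A : Mat n} (h : mcgm A = 0) {t : ℕ} (ht : n ≤ t)
    (i j : Fin n) : mpow A t i j = 0 := by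
  by_contra hne
  obtain ⟨a, b, e, p, -, hb, -, -, hle⟩ := mpow_cut (d := 1) one_pos (by omega) hne
  have := mpow_diag_le A b p
  rw [h, zero_pow hb.ne'] at this
  rw [le_antisymm this (zero_le)] at hle
  exact hne (le_antisymm (by simpa using hle) (zero_le))

/-- Closed walks of mean at most `ρ` can be removed until the length of a walk is bounded, without
changing the length modulo `d`. -/
theorem exists_short_walk {A : Mat n} {ρ : ℝ≥0} (hA : mcgm A ≤ ρ) {d : ℕ} (hd : 0 < d) (t : ℕ)
    (i j : Fin n) :
    ∃ u ≤ n * d, u ≡ t [MOD d] ∧ mpow A t i j * ρ ^ u ≤ mpow A u i j * ρ ^ t := by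
  induction t using Nat.strong_induction_on with
  | _ t ih =>
    rcases le_or_gt t (n * d) with ht | ht
    · exact ⟨t, ht, rfl, le_rfl⟩
    by_cases h : mpow A t i j = 0
    · refine ⟨t % d, ?_, Nat.mod_modEq t d, by simp [h]⟩
      have := Nat.mod_lt t hd
      have : 0 < n := i.pos
      nlinarith
    obtain ⟨a, b, e, p, habe, hb, -, hdb, hle⟩ := mpow_cut hd ht.le h
    obtain ⟨u, hu, hmod, hle'⟩ := ih (a + e) (by omega)
    refine ⟨u, hu, hmod.trans ?_, ?_⟩
    · rw [← habe, show a + b + e = a + e + b by ring]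
      obtain ⟨q, rfl⟩ := hdb
      simp [Nat.ModEq]
    · calc mpow A t i j * ρ ^ u
          ≤ mpow A a i p * mpow A b p p * mpow A e p j * ρ ^ u := mul_le_mul_left hle _
        _ = mpow A b p p * (mpow A a i p * mpow A e p j * ρ ^ u) := by ring
        _ ≤ ρ ^ b * (mpow A (a + e) i j * ρ ^ u) :=
          mul_le_mul' ((mpow_diag_le A b p).trans (pow_le_pow_left₀ (zero_le) hA b))
            (mul_le_mul_left (mpow_mul_le A a e i p j) _)
        _ ≤ ρ ^ b * (mpow A u i j * ρ ^ (a + e)) := mul_le_mul_right hle' _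
        _ = mpow A u i j * ρ ^ t := by rw [← habe]; ring

/-- By `exists_short_walk` with modulus `1`, finitely many lengths decide the constant. -/
theorem exists_mpow_le {A : Mat n} {ρ : ℝ≥0} (hA : mcgm A ≤ ρ) (hρ : ρ ≠ 0) :
    ∃ C : ℝ≥0, ∀ t i j, mpow A t i j ≤ C * ρ ^ t := by
  refine ⟨Finset.univ.sup fun i => Finset.univ.sup fun j => (Finset.range (n * 1 + 1)).sup fun u =>
    mpow A u i j / ρ ^ u, fun t i j => ?_⟩
  obtain ⟨u, hu, -, hle⟩ := exists_short_walk hA one_pos t i j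
  have h₁ : mpow A t i j ≤ mpow A u i j / ρ ^ u * ρ ^ t := by
    rw [div_mul_eq_mul_div]
    exact (le_div_iff₀ (pow_pos (pos_iff_ne_zero.2 hρ) u)).2 hle
  refine h₁.trans (mul_le_mul_left ?_ _)
  refine le_trans ?_ (Finset.le_sup (Finset.mem_univ i))
  refine le_trans ?_ (Finset.le_sup (Finset.mem_univ j))
  exact Finset.le_sup (f := fun u => mpow A u i j / ρ ^ u) (Finset.mem_range.2 (by omega))

/-! The critical digraph -/

/-- The matrix of the critical edges. -/
noncomputable abbrev crit (A : Mat n) : Mat n := csrS A (CritEdge A)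

theorem CritEdge.ne_zero {A : Mat n} {i j : Fin n} (h : CritEdge A i j) : A i j ≠ 0 := by
  obtain ⟨k, c, hc, -, t, ht, rfl, rfl⟩ := h
  exact hc.2.2 t ht

theorem crit_ne_zero_iff {A : Mat n} {i j : Fin n} : crit A i j ≠ 0 ↔ CritEdge A i j := by
  unfold crit csrS
  split_ifs with h
  · simp [h, h.ne_zero]
  · simp [h]

theorem edge_crit (A : Mat n) : Edge (crit A) = CritEdge A := by
  ext i j
  exact crit_ne_zero_iff

theorem crit_le (A : Mat n) (i j : Fin n) : crit A i j ≤ A i j := by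
  unfold crit csrS
  split_ifs <;> simp

/-- The rest of a critical cycle through the edge leads back with the complementary weight. -/
theorem CritEdge.exists_return {A : Mat n} {i j : Fin n} (h : CritEdge A i j) :
    ∃ l, mcgm A ^ (l + 1) ≤ A i j * mpow A l j i := by
  obtain ⟨k, c, hc, hm, t, ht, rfl, rfl⟩ := h
  refine ⟨(k - (t + 1)) + t, ?_⟩
  rw [cycleMean_eq_iff A hc.1] at hm
  obtain ⟨e, rfl⟩ := Nat.exists_eq_add_of_le (Nat.succ_le_of_lt ht)
  rw [show t + 1 + e - (t + 1) = e by omega, show e + t + 1 = t + 1 + e by ring, ← hm, weight_add,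
    weight_succ]
  have e₁ := weight_le_mpow A t c
  have e₂ := weight_le_mpow A e (fun s => c (t + 1 + s))
  rw [hc.2.1, Nat.add_zero] at e₂
  calc _ ≤ mpow A t (c 0) (c t) * A (c t) (c (t + 1)) * mpow A e (c (t + 1)) (c 0) :=
        mul_le_mul' (mul_le_mul_left e₁ _) e₂
    _ = A (c t) (c (t + 1)) * (mpow A e (c (t + 1)) (c 0) * mpow A t (c 0) (c t)) := by ring
    _ ≤ _ := mul_le_mul_right (mpow_mul_le _ _ _ _ _ _) _

/-- An optimal closed walk is itself an admissible cycle in `CritEdge`, which requires neither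
simplicity nor a bound on the length. -/
theorem isNode_critEdge_of_mpow_diag {A : Mat n} (h : mcgm A ≠ 0) {k : ℕ} (hk : 0 < k) {i : Fin n}
    (hki : mpow A k i i = mcgm A ^ k) : IsNode (CritEdge A) i := by
  have h0 : mpow A k i i ≠ 0 := by rw [hki]; exact pow_ne_zero _ h
  obtain ⟨c, hc0, hck, hw⟩ := exists_weight_eq h0
  refine ⟨c 1, Or.inl ⟨k, c, ⟨hk, hck.trans hc0.symm, fun t ht => ?_⟩, ?_, 0, hk, hc0, rfl⟩⟩
  · exact edge_of_weight_ne_zero (by rw [hw]; exact h0) ht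
  · rw [cycleMean_eq_iff A hk, hw, hki]

theorem exists_isNode_critEdge {A : Mat n} (h : mcgm A ≠ 0) : ∃ i, IsNode (CritEdge A) i := by
  obtain ⟨k, i, hk, hki⟩ := exists_mpow_diag_eq h
  exact ⟨i, isNode_critEdge_of_mpow_diag h hk hki⟩

theorem exists_return_crit {A : Mat n} {l : ℕ} {i j : Fin n}
    (hl : mpow (crit A) l i j ≠ 0) :
    ∃ l', mcgm A ^ (l + l') ≤ mpow A l i j * mpow A l' j i := by
  induction l generalizing j with
  | zero =>
    obtain rfl := mpow_zero_ne_zero hl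
    exact ⟨0, by simp⟩
  | succ l ih =>
    obtain ⟨k, h₁, h₂⟩ := (mmul_ne_zero_iff _ _ _ _).1 hl
    obtain ⟨l₁, hl₁⟩ := ih h₁
    obtain ⟨l₂, hl₂⟩ := (crit_ne_zero_iff.1 h₂).exists_return
    refine ⟨l₂ + l₁, ?_⟩
    calc mcgm A ^ (l + 1 + (l₂ + l₁)) = mcgm A ^ (l + l₁) * mcgm A ^ (l₂ + 1) := by ring
      _ ≤ mpow A l i k * mpow A l₁ k i * (A k j * mpow A l₂ j k) := mul_le_mul' hl₁ hl₂
      _ = mpow A l i k * A k j * (mpow A l₂ j k * mpow A l₁ k i) := by ring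
      _ ≤ _ := mul_le_mul' (mul_le_mmul _ _ _ _ _) (mpow_mul_le _ _ _ _ _ _)

/-- Closed critical walks have maximal weight. -/
theorem pow_le_mpow_diag {A : Mat n} (h : mcgm A ≠ 0) {l : ℕ} {i : Fin n}
    (hl : mpow (crit A) l i i ≠ 0) : mcgm A ^ l ≤ mpow A l i i := by
  obtain ⟨l', hl'⟩ := exists_return_crit hl
  -- The return walk is closed too, so its weight is at most the corresponding power of `mcgm A` and
  -- cancels.
  have := hl'.trans (mul_le_mul_right (mpow_diag_le A l' i) (mpow A l i i))
  rw [pow_add] at this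
  exact le_of_mul_le_mul_right this (pow_pos (pos_iff_ne_zero.2 h) l')

theorem crit_walk_ne_zero {A : Mat n} {l : ℕ} {i j : Fin n}
    (h : mpow (crit A) l i j ≠ 0) : mpow A l i j ≠ 0 :=
  ne_zero_of_le (mpow_mono (crit_le A) l i j) h

theorem exists_crit_cycle {A : Mat n} {i : Fin n} (h : IsNode (CritEdge A) i) :
    ∃ k c, IsCycle (CritEdge A) k c ∧ c 0 = i := by
  have key : ∀ k c, IsCycle (Edge A) k c → cycleMean A k c = mcgm A → ∀ t ≤ k, c t = i →
      ∃ k c, IsCycle (CritEdge A) k c ∧ c 0 = i := by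
    intro k c hc hm t ht hti
    have hE : ∀ s < k, CritEdge A (c s) (c (s + 1)) := fun s hs => ⟨k, c, hc, hm, s, hs, rfl, rfl⟩
    -- The cycle is rotated so that it starts at position `t`.
    refine ⟨k, fun s => if t + s ≤ k then c (t + s) else c (t + s - k), ⟨hc.1, ?_, ?_⟩, ?_⟩
    · rcases Nat.eq_zero_or_pos t with rfl | h0
      · simp [hc.2.1]
      · have h₁ : ¬ t + k ≤ k := by omega
        have h₂ : t + k - k = t := by omega
        simp only [h₁, h₂, if_false, Nat.add_zero, ht, if_true]
    · intro s hs
      simp only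
      rcases lt_trichotomy (t + s) k with h | h | h
      · rw [if_pos h.le, if_pos (by omega)]
        exact hE _ h
      · rw [if_pos h.le, if_neg (by omega), h, hc.2.1, show t + (s + 1) - k = 0 + 1 by omega]
        exact hE 0 hc.1
      · rw [if_neg (by omega), if_neg (by omega), show t + (s + 1) - k = t + s - k + 1 by omega]
        exact hE _ (by omega)
    · simpa [ht] using hti
  obtain ⟨j, ⟨k, c, hc, hm, t, ht, h₁, h₂⟩ | ⟨k, c, hc, hm, t, ht, h₁, h₂⟩⟩ := h
  · exact key k c hc hm t ht.le h₁
  · exact key k c hc hm (t + 1) ht h₂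

theorem SameComp.trans {E : Fin n → Fin n → Prop} {i j k : Fin n} (h : SameComp E i j)
    (h' : SameComp E j k) : SameComp E i k :=
  ⟨Relation.ReflTransGen.trans h.1 h'.1, Relation.ReflTransGen.trans h'.2 h.2⟩

theorem IsCycle.access {E : Fin n → Fin n → Prop} {k : ℕ} {c : ℕ → Fin n} (hc : IsCycle E k c)
    {s t : ℕ} (hst : s ≤ t) (ht : t ≤ k) : Access E (c s) (c t) := by
  induction t, hst using Nat.le_induction with
  | base => exact Relation.ReflTransGen.refl
  | succ t _ ih => exact (ih (by omega)).tail (hc.2.2 t (by omega))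

/-- A shortest cycle in the component is simple, hence of length at most `n`, so the g.c.d. involves
a positive number. An empty g.c.d. would be `0`. -/
theorem compCyclicity_ne_zero {E : Fin n → Fin n → Prop} {i : Fin n}
    (h : ∃ k c, IsCycle E k c ∧ SameComp E (c 0) i) : compCyclicity E i ≠ 0 := by
  classical
  obtain ⟨c, hc, hci⟩ := Nat.find_spec h
  set k := Nat.find h with hk
  have key : ∀ a b, a < b → b < k → c a ≠ c b := by
    intro a b hab hb heq
    have := Nat.find_min h (m := b - a) (by omega)
    apply this
    refine ⟨fun s => c (a + s), ⟨by omega, ?_, ?_⟩, ?_⟩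
    · simp only [Nat.add_zero]
      rw [show a + (b - a) = b by omega, heq]
    · intro t ht
      exact hc.2.2 (a + t) (by omega)
    · refine SameComp.trans ⟨?_, hc.access (Nat.zero_le a) (by omega)⟩ hci
      have := hc.access (s := a) (t := k) (by omega) le_rfl
      rwa [hc.2.1] at this
  have hinj : Set.InjOn c (Set.Iio k) := by
    intro a ha b hb hab
    simp only [Set.mem_Iio] at ha hb
    rcases lt_trichotomy a b with h | h | h
    · exact absurd hab (key a b h hb)
    · exact h
    · exact absurd hab.symm (key b a h ha)
  have hkn : k ≤ n := by
    have := Finset.card_le_card_of_injOn (s := Finset.range k) (t := Finset.univ) c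
      (fun _ _ => Finset.mem_univ _) (by simpa using hinj)
    simpa using this
  intro h0
  rw [compCyclicity, Finset.gcd_eq_zero_iff] at h0
  have := h0 k (by simp only [Finset.mem_filter, Finset.mem_Icc]
                   exact ⟨⟨hc.1, hkn⟩, c, ⟨hc, hinj⟩, hci⟩)
  exact hc.1.ne' this

theorem cyclicity_critEdge_ne_zero (A : Mat n) : cyclicity (CritEdge A) ≠ 0 := by
  rw [cyclicity, Ne, Finset.lcm_eq_zero_iff]
  rintro ⟨i, hi, h0⟩
  refine compCyclicity_ne_zero ?_ h0
  obtain ⟨k, c, hc, rfl⟩ := exists_crit_cycle (A := A) (i := i) (by simpa using hi)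
  exact ⟨k, c, hc, Relation.ReflTransGen.refl, Relation.ReflTransGen.refl⟩

/-- There are closed critical walks of all large lengths divisible by the cyclicity. -/
theorem exists_crit_loops {A : Mat n} {i : Fin n} (h : IsNode (CritEdge A) i) :
    ∃ l₀, ∀ m ≥ l₀, cyclicity (CritEdge A) ∣ m → mpow (crit A) m i i ≠ 0 := by
  -- The return lengths at `i` form a submonoid of `ℕ`, which contains all large multiples of its
  -- g.c.d. It remains to see that this g.c.d. divides the cyclicity.
  let L : AddSubmonoid ℕ :=
    { carrier := {l | mpow (crit A) l i i ≠ 0}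
      zero_mem' := by simp
      add_mem' := fun ha hb => mpow_add_ne_zero ha hb }
  obtain ⟨l₀, hl₀⟩ := Nat.exists_mem_closure_of_ge (L : Set ℕ)
  refine ⟨l₀, fun m hm hdvd => ?_⟩
  have hL : m ∈ L := by
    rw [← AddSubmonoid.closure_eq L]
    refine hl₀ m hm (dvd_trans ?_ hdvd)
    have h₁ : compCyclicity (CritEdge A) i ∣ cyclicity (CritEdge A) :=
      Finset.dvd_lcm (f := fun i => compCyclicity (CritEdge A) i) (by simpa using h)
    refine dvd_trans (Finset.dvd_gcd fun s hs => ?_) h₁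
    simp only [Finset.mem_filter] at hs
    obtain ⟨-, c, ⟨hc, -⟩, hcomp⟩ := hs
    rw [SameComp, ← edge_crit, access_iff, access_iff] at hcomp
    obtain ⟨⟨p, hp⟩, ⟨q, hq⟩⟩ := hcomp
    have hs : mpow (crit A) s (c 0) (c 0) ≠ 0 := by
      have := weight_le_mpow (crit A) s c
      rw [hc.2.1] at this
      exact ne_zero_of_le this (weight_ne_zero fun t ht => crit_ne_zero_iff.2 (hc.2.2 t ht))
    -- Going to the cycle and back, with or without one turn of it, gives two return lengths that
    -- differ by `s`.
    have m₁ : q + p ∈ (L : Set ℕ) := mpow_add_ne_zero hq hp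
    have m₂ : q + s + p ∈ (L : Set ℕ) := mpow_add_ne_zero (mpow_add_ne_zero hq hs) hp
    have d₁ := Nat.setGcd_dvd_of_mem m₁
    have d₂ := Nat.setGcd_dvd_of_mem m₂
    rw [show q + s + p = s + (q + p) by ring] at d₂
    exact (Nat.dvd_add_left d₁).1 d₂
  exact hL

/-! Powers modulo a multiple of the cyclicity of the critical digraph -/

theorem exists_split {A : Mat n} {t s : ℕ} (hs : s ≤ t) {i j : Fin n} (h : mpow A t i j ≠ 0) :
    ∃ p, mpow A s i p ≠ 0 ∧ mpow A (t - s) p j ≠ 0 := by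
  obtain ⟨c, rfl, rfl, hw⟩ := exists_weight_eq h
  rw [← hw] at h
  have := ne_zero_of_le (weight_le_mul A hs c) h
  exact ⟨c s, left_ne_zero_of_mul this, right_ne_zero_of_mul this⟩

theorem mpow_add (A : Mat n) (a b : ℕ) : mpow A (a + b) = mmul (mpow A a) (mpow A b) := by
  funext i j
  apply le_antisymm
  · by_cases h : mpow A (a + b) i j = 0
    · rw [h]; exact zero_le
    obtain ⟨c, rfl, rfl, hw⟩ := exists_weight_eq h
    rw [← hw]
    have := weight_le_mul A (Nat.le_add_right a b) c
    rw [Nat.add_sub_cancel_left] at this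
    exact this.trans (mul_le_mmul _ _ _ _ _)
  · obtain ⟨k, hk⟩ := exists_mmul_eq (mpow A a) (mpow A b) i j
    rw [hk]
    exact mpow_mul_le A a b i k j

theorem mpow_mpow (A : Mat n) (g s : ℕ) : mpow (mpow A g) s = mpow A (g * s) := by
  induction s with
  | zero => rfl
  | succ s ih => rw [Nat.mul_succ, mpow_add A, ← ih]; rfl

theorem restrict_le (A : Mat n) (K : Set (Fin n)) (i j : Fin n) : restrict A K i j ≤ A i j := by
  unfold restrict
  split_ifs <;> simp

theorem restrict_ne_zero {A : Mat n} {K : Set (Fin n)} {i j : Fin n}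
    (h : restrict A K i j ≠ 0) : i ∈ K ∧ j ∈ K := by
  by_contra h'
  exact h (if_neg h')

/-- The hypothesis confines every walk of length `t` from `i` to `j` to `K`, so none is lost by the
restriction. -/
theorem mpow_restrict_eq {A : Mat n} {K : Set (Fin n)} {t : ℕ} {i j : Fin n}
    (h : ∀ s s' p, s + s' = t → mpow A s i p ≠ 0 → mpow A s' p j ≠ 0 → p ∈ K) :
    mpow (restrict A K) t i j = mpow A t i j := by
  apply le_antisymm (mpow_mono (restrict_le A K) t i j)
  by_cases h0 : mpow A t i j = 0
  · rw [h0]; exact zero_le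
  obtain ⟨c, rfl, rfl, hw⟩ := exists_weight_eq h0
  rw [← hw] at h0
  have hK : ∀ s ≤ t, c s ∈ K := fun s hs => by
    have := ne_zero_of_le (weight_le_mul A hs c) h0
    exact h s (t - s) (c s) (by omega) (left_ne_zero_of_mul this) (right_ne_zero_of_mul this)
  rw [← hw]
  refine le_trans (le_of_eq (weight_congr fun s hs => ?_)) (weight_le_mpow _ t c)
  exact (if_pos ⟨hK s hs.le, hK (s + 1) hs⟩).symm

/-- Removing all critical nodes decreases the maximum cycle geometric mean. -/
theorem mcgm_restrict_lt {A : Mat n} (h : mcgm A ≠ 0) {K : Set (Fin n)}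
    (hK : ∀ i ∈ K, ¬ IsNode (CritEdge A) i) : mcgm (restrict A K) < mcgm A := by
  refine lt_of_le_of_ne (mcgm_mono (restrict_le A K)) fun heq => ?_
  obtain ⟨k, i, hk, hki⟩ := exists_mpow_diag_eq (heq.trans_ne h)
  rw [heq] at hki
  have h0 : mpow (restrict A K) k i i ≠ 0 := by rw [hki]; exact pow_ne_zero _ h
  obtain ⟨c, rfl, hc, hw⟩ := exists_weight_eq h0
  rw [← hw] at h0
  refine hK (c 0) (restrict_ne_zero (edge_of_weight_ne_zero h0 hk)).1
    (isNode_critEdge_of_mpow_diag h hk (le_antisymm (mpow_diag_le A k _) ?_))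
  rw [← hki]
  exact mpow_mono (restrict_le A K) k _ _

theorem eventually_mul_pow_le {ρ L F : ℝ≥0} (C : ℝ≥0) (h : ρ < L) (hF : F ≠ 0) :
    ∀ᶠ t : ℕ in Filter.atTop, C * ρ ^ t ≤ F * L ^ t := by
  have hL : 0 < L := lt_of_le_of_lt zero_le h
  have h1 : ρ / L < 1 := (div_lt_one hL).2 h
  have ht : Filter.Tendsto (fun t : ℕ => C * (ρ / L) ^ t) Filter.atTop (nhds 0) := by
    simpa using (NNReal.tendsto_pow_atTop_nhds_zero_of_lt_one h1).const_mul C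
  filter_upwards [ht.eventually (gt_mem_nhds (pos_iff_ne_zero.2 hF))] with t ht
  rw [div_pow, ← mul_div_assoc, div_lt_iff₀ (pow_pos hL t)] at ht
  exact ht.le

/-- If there is a walk of length `r` modulo `d` through a critical node, then the powers `t ≡ r`
are ultimately geometric. -/
theorem eventually_mpow_eq {A : Mat n} (h : mcgm A ≠ 0) {d : ℕ} (hd : 0 < d)
    (hcyc : cyclicity (CritEdge A) ∣ d) {i j k : Fin n} {r a b : ℕ} (hk : IsNode (CritEdge A) k)
    (ha : mpow A a i k ≠ 0) (hb : mpow A b k j ≠ 0) (hab : a + b ≡ r [MOD d]) :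
    ∃ F : ℝ≥0, F ≠ 0 ∧ ∀ᶠ t in Filter.atTop, t ≡ r [MOD d] → mpow A t i j = F * mcgm A ^ t := by
  classical
  set L := mcgm A with hL
  have hLpos : 0 < L := pos_iff_ne_zero.2 h
  let R := Finset.range (n * d + 1)
  -- The constant `F` will be the best normalized weight of a walk of the right residue that passes
  -- a critical node with both halves of length at most `n * d`.
  let Q : Finset (Fin n × ℕ × ℕ) := (Finset.univ ×ˢ R ×ˢ R).filter fun q =>
    IsNode (CritEdge A) q.1 ∧ q.2.1 + q.2.2 ≡ r [MOD d]
  let f : Fin n × ℕ × ℕ → ℝ≥0 := fun q =>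
    mpow A q.2.1 i q.1 * mpow A q.2.2 q.1 j / L ^ (q.2.1 + q.2.2)
  set F := Q.sup f with hF
  -- The halves before and after the critical node are shortened separately, each preserving its
  -- length modulo `d`.
  have upper : ∀ k a b, IsNode (CritEdge A) k → a + b ≡ r [MOD d] →
      mpow A a i k * mpow A b k j ≤ F * L ^ (a + b) := by
    intro k a b hk hab
    obtain ⟨u, hu, hua, hle⟩ := exists_short_walk (A := A) le_rfl hd a i k
    obtain ⟨w, hw, hwb, hle'⟩ := exists_short_walk (A := A) le_rfl hd b k j
    have hq : (k, u, w) ∈ Q := by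
      simp only [Q, R, Finset.mem_filter, Finset.mem_product, Finset.mem_univ, Finset.mem_range,
        true_and]
      exact ⟨⟨by omega, by omega⟩, hk, (hua.add hwb).trans hab⟩
    have h₁ : f (k, u, w) ≤ F := Finset.le_sup hq
    have h₂ : mpow A u i k * mpow A w k j ≤ F * L ^ (u + w) :=
      (div_le_iff₀ (pow_pos hLpos _)).1 h₁
    refine le_of_mul_le_mul_right ?_ (pow_pos hLpos (u + w))
    calc mpow A a i k * mpow A b k j * L ^ (u + w)
        = (mpow A a i k * L ^ u) * (mpow A b k j * L ^ w) := by ring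
      _ ≤ (mpow A u i k * L ^ a) * (mpow A w k j * L ^ b) := mul_le_mul' hle hle'
      _ = (mpow A u i k * mpow A w k j) * L ^ (a + b) := by ring
      _ ≤ F * L ^ (u + w) * L ^ (a + b) := mul_le_mul_left h₂ _
      _ = F * L ^ (a + b) * L ^ (u + w) := by ring
  have hF0 : F ≠ 0 :=
    left_ne_zero_of_mul (ne_zero_of_le (upper k a b hk hab) (mul_ne_zero ha hb))
  have hQ : Q.Nonempty := by
    rw [Finset.nonempty_iff_ne_empty]
    intro hQ
    rw [hF, hQ] at hF0
    exact hF0 rfl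
  obtain ⟨⟨k₀, a₀, b₀⟩, hq₀, hF₀⟩ := Finset.exists_mem_eq_sup Q hQ f
  obtain ⟨hk₀, hab₀⟩ : IsNode (CritEdge A) k₀ ∧ a₀ + b₀ ≡ r [MOD d] :=
    (Finset.mem_filter.1 hq₀).2
  obtain ⟨l₀, hl₀⟩ := exists_crit_loops hk₀
  -- Walks that avoid all critical nodes have a strictly smaller growth rate and are ultimately
  -- dominated.
  have hlt : mcgm (restrict A {i | ¬ IsNode (CritEdge A) i}) < L :=
    mcgm_restrict_lt h fun i hi => hi
  obtain ⟨ρ, hρ₁, hρ₂⟩ := exists_between hlt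
  obtain ⟨C, hC⟩ := exists_mpow_le hρ₁.le (lt_of_le_of_lt zero_le hρ₁).ne'
  refine ⟨F, hF0, ?_⟩
  filter_upwards [eventually_mul_pow_le C hρ₂ hF0, Filter.eventually_ge_atTop (a₀ + b₀ + l₀)]
    with t ht₁ ht₂ ht
  apply le_antisymm
  · by_cases h0 : mpow A t i j = 0
    · rw [h0]; exact zero_le
    obtain ⟨c, rfl, rfl, hw⟩ := exists_weight_eq h0
    rw [← hw]
    by_cases hN : ∃ s ≤ t, IsNode (CritEdge A) (c s)
    · obtain ⟨s, hs, hsN⟩ := hN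
      have e : s + (t - s) = t := by omega
      have := upper (c s) s (t - s) hsN (by rwa [e])
      rw [e] at this
      exact (weight_le_mul A hs c).trans this
    · push Not at hN
      refine le_trans ?_ ((hC t (c 0) (c t)).trans ht₁)
      refine le_trans (le_of_eq (weight_congr fun s hs => ?_)) (weight_le_mpow _ t c)
      exact (if_pos ⟨hN s hs.le, hN (s + 1) hs⟩).symm
  · obtain ⟨m, rfl⟩ := Nat.exists_eq_add_of_le (show a₀ + b₀ ≤ t by omega)
    have hdm : d ∣ m := by
      have h₁ : a₀ + b₀ + m ≡ a₀ + b₀ + 0 [MOD d] := by simpa using ht.trans hab₀.symm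
      exact (Nat.modEq_zero_iff_dvd).1 (Nat.ModEq.add_left_cancel' _ h₁)
    -- For the lower bound, the missing length `m` is filled by a closed critical walk at `k₀`.
    have hm := pow_le_mpow_diag h (hl₀ m (by omega) (hcyc.trans hdm))
    have hF₁ : F * L ^ (a₀ + b₀) = mpow A a₀ i k₀ * mpow A b₀ k₀ j := by
      rw [hF, hF₀]
      exact div_mul_cancel₀ _ (pow_ne_zero _ h)
    calc F * L ^ (a₀ + b₀ + m) = F * L ^ (a₀ + b₀) * L ^ m := by ring
      _ = mpow A a₀ i k₀ * (L ^ m * mpow A b₀ k₀ j) := by rw [hF₁]; ring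
      _ ≤ mpow A a₀ i k₀ * (mpow A m k₀ k₀ * mpow A b₀ k₀ j) :=
        mul_le_mul_right (mul_le_mul_left hm _) _
      _ ≤ mpow A a₀ i k₀ * mpow A (m + b₀) k₀ j := mul_le_mul_right (mpow_mul_le _ _ _ _ _ _) _
      _ ≤ mpow A (a₀ + (m + b₀)) i j := mpow_mul_le _ _ _ _ _ _
      _ = mpow A (a₀ + b₀ + m) i j := by congr 1; ring

/-! The support of the products `C ⊗ S ⊗ R` -/

theorem mpow_scale (A : Mat n) (l : ℝ≥0) (t : ℕ) (i j : Fin n) :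
    mpow (scale A l) t i j = mpow A t i j / l ^ t := by
  induction t generalizing j with
  | zero => simp [mpow]
  | succ t ih =>
    change mmul (mpow (scale A l) t) (scale A l) i j = mmul (mpow A t) A i j / l ^ (t + 1)
    rw [div_eq_inv_mul, mmul, mmul, NNReal.mul_finset_sup]
    refine Finset.sup_congr rfl fun k _ => ?_
    rw [ih, scale, pow_succ, mul_inv]
    ring

/-- The supremum in `star` detects nonzero terms only if the family is bounded; dividing by `mcgm A`
ensures this. -/
theorem csrB_ne_zero_iff {A : Mat n} (h : mcgm A ≠ 0) (E : Fin n → Fin n → Prop) (i j : Fin n) :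
    csrB (scale A (mcgm A)) E i j ≠ 0 ↔ ∃ s, mpow A (cyclicity E * s) i j ≠ 0 := by
  obtain ⟨C, hC⟩ := exists_mpow_le (A := A) le_rfl h
  have hp : ∀ s, mpow (mpow (scale A (mcgm A)) (cyclicity E)) s i j =
      mpow A (cyclicity E * s) i j / mcgm A ^ (cyclicity E * s) := fun s => by
    rw [mpow_mpow, mpow_scale]
  have hb : BddAbove (Set.range fun s =>
      mpow (mpow (scale A (mcgm A)) (cyclicity E)) s i j) := by
    refine ⟨C, ?_⟩
    rintro _ ⟨s, rfl⟩
    simp only [hp]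
    exact (div_le_iff₀ (pow_pos (pos_iff_ne_zero.2 h) _)).2 (hC _ _ _)
  have hs : ∀ s, mpow (mpow (scale A (mcgm A)) (cyclicity E)) s i j ≠ 0 ↔
      mpow A (cyclicity E * s) i j ≠ 0 := fun s => by
    rw [hp]
    simp [h]
  simp only [← hs]
  constructor
  · intro h0
    by_contra! hn
    apply h0
    simp [csrB, star, hn]
  · rintro ⟨s, h0⟩
    exact ne_zero_of_le (le_ciSup hb s) h0

theorem csr_ne_zero_iff {A : Mat n} (h : mcgm A ≠ 0) (i j : Fin n) :
    csr (scale A (mcgm A)) (CritEdge A) 1 i j ≠ 0 ↔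
      ∃ k k' s s', CritEdge A k k' ∧ mpow A (cyclicity (CritEdge A) * s) i k ≠ 0 ∧
        mpow A (cyclicity (CritEdge A) * s') k' j ≠ 0 := by
  have hS : ∀ k k', csrS (scale A (mcgm A)) (CritEdge A) k k' ≠ 0 ↔ CritEdge A k k' := by
    intro k k'
    unfold csrS
    split_ifs with hE
    · simp [hE, scale, h, hE.ne_zero]
    · simp [hE]
  have hC : ∀ k, csrC (scale A (mcgm A)) (CritEdge A) i k ≠ 0 ↔
      IsNode (CritEdge A) k ∧ ∃ s, mpow A (cyclicity (CritEdge A) * s) i k ≠ 0 := by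
    intro k
    unfold csrC
    split_ifs with hE
    · simp only [hE, csrB_ne_zero_iff h, true_and]
    · simp [hE]
  have hR : ∀ k, csrR (scale A (mcgm A)) (CritEdge A) k j ≠ 0 ↔
      IsNode (CritEdge A) k ∧ ∃ s, mpow A (cyclicity (CritEdge A) * s) k j ≠ 0 := by
    intro k
    unfold csrR
    split_ifs with hE
    · simp only [hE, csrB_ne_zero_iff h, true_and]
    · simp [hE]
  rw [csr, mmul_ne_zero_iff]
  simp only [mmul_ne_zero_iff, mpow_one, hS, hC, hR]
  constructor
  · rintro ⟨k', ⟨k, ⟨-, s, hs⟩, hE⟩, -, s', hs'⟩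
    exact ⟨k, k', s, s', hE, hs, hs'⟩
  · rintro ⟨k, k', s, s', hE, hs, hs'⟩
    exact ⟨k', ⟨k, ⟨⟨k', Or.inl hE⟩, s, hs⟩, hE⟩, ⟨k, Or.inr hE⟩, s', hs'⟩

/-- The factors `C` and `R` force lengths divisible by `g` on either side of a critical edge. Any
critical node on the walk allows this: a closed critical walk inserted there has an edge starting
exactly when the elapsed length is a multiple of `g`. -/
theorem csr_ne_zero_iff_walk {A : Mat n} (h : mcgm A ≠ 0) (i j : Fin n) :
    csr (scale A (mcgm A)) (CritEdge A) 1 i j ≠ 0 ↔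
      ∃ k a b, IsNode (CritEdge A) k ∧ mpow A a i k ≠ 0 ∧ mpow A b k j ≠ 0 ∧
        a + b ≡ 1 [MOD cyclicity (CritEdge A)] := by
  set g := cyclicity (CritEdge A) with hg
  have hg0 : 0 < g := Nat.pos_of_ne_zero (cyclicity_critEdge_ne_zero A)
  rw [csr_ne_zero_iff h]
  constructor
  · rintro ⟨k, k', s, s', hE, hs, hs'⟩
    refine ⟨k, g * s, 1 + g * s', ⟨k', Or.inl hE⟩, hs,
      mpow_add_ne_zero (by rw [mpow_one]; exact hE.ne_zero) hs', ?_⟩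
    rw [show g * s + (1 + g * s') = 1 + g * (s + s') by ring]
    simp [Nat.ModEq]
  · rintro ⟨k, a, b, hk, ha, hb, hab⟩
    obtain ⟨l₀, hl₀⟩ := exists_crit_loops hk
    -- The position on a closed critical walk that is reached at a multiple of `g`.
    obtain ⟨c, hc⟩ : ∃ c, c + a = g * (a + 1) := ⟨g * (a + 1) - a, by
      have : a ≤ g * (a + 1) := by nlinarith
      omega⟩
    have hloop := hl₀ (g * (l₀ + a + 2)) (by nlinarith) (dvd_mul_right _ _)
    have hcm : c + 1 ≤ g * (l₀ + a + 2) := by nlinarith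
    obtain ⟨q, hq₁, hq₂⟩ := exists_split hcm hloop
    obtain ⟨p, hp₁, hp₂⟩ := (mmul_ne_zero_iff _ _ _ _).1 hq₁
    have e₁ := mpow_add_ne_zero ha (crit_walk_ne_zero hp₁)
    have e₂ := mpow_add_ne_zero (crit_walk_ne_zero hq₂) hb
    rw [add_comm a c, hc] at e₁
    have hdvd : g ∣ g * (l₀ + a + 2) - (c + 1) + b := by
      rw [← Nat.modEq_zero_iff_dvd]
      refine Nat.ModEq.add_right_cancel' (c + 1 + a) ?_
      have e : g * (l₀ + a + 2) - (c + 1) + b + (c + 1 + a) = (a + b) + g * (l₀ + a + 2) := by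
        omega
      have e' : 0 + (c + 1 + a) = 1 + g * (a + 1) := by omega
      rw [e, e']
      refine (Nat.ModEq.add_right _ hab).trans ?_
      simp [Nat.ModEq]
    obtain ⟨s', hs'⟩ := hdvd
    rw [hs'] at e₂
    exact ⟨p, q, a + 1, s', crit_ne_zero_iff.1 hp₂, e₁, e₂⟩

/-! The ultimate expansion -/

theorem ultK_succ_subset (A : Mat n) (μ : ℕ) : ultK A (μ + 1) ⊆ ultK A μ := Set.sdiff_subset

theorem mem_ultK_of_isNode {A : Mat n} {μ : ℕ} {i : Fin n} (h : IsNode (CritEdge (ultA A μ)) i) :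
    i ∈ ultK A μ := by
  obtain ⟨j, h | h⟩ := h
  · exact (restrict_ne_zero h.ne_zero).1
  · exact (restrict_ne_zero h.ne_zero).2

theorem notMem_ultK_succ_of_isNode {A : Mat n} {μ : ℕ} {i : Fin n}
    (h : IsNode (CritEdge (ultA A μ)) i) : i ∉ ultK A (μ + 1) := fun hi =>
  hi.2 ⟨i, h, Relation.ReflTransGen.refl, Relation.ReflTransGen.refl⟩

theorem exists_isNode_of_notMem_ultK {A : Mat n} {ν : ℕ} {p : Fin n} (h : p ∉ ultK A ν) :
    ∃ μ < ν, ∃ k, IsNode (CritEdge (ultA A μ)) k ∧ SameComp (Edge A) p k := by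
  induction ν with
  | zero => exact absurd (Set.mem_univ p) h
  | succ ν ih =>
    by_cases hp : p ∈ ultK A ν
    · by_contra hn
      exact h ⟨hp, fun ⟨k, hk, hpk⟩ => hn ⟨ν, Nat.lt_succ_self ν, k, hk, hpk⟩⟩
    · obtain ⟨μ, hμ, hk⟩ := ih hp
      exact ⟨μ, by omega, hk⟩

/-- Each step with a nonzero value has a critical node and removes at least that node. -/
theorem ncard_ultK_add_le {A : Mat n} {ν : ℕ} (h : ∀ μ < ν, ultLambda A μ ≠ 0) :
    (ultK A ν).ncard + ν ≤ n := by
  induction ν with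
  | zero => simp [ultK]
  | succ ν ih =>
    obtain ⟨i, hi⟩ := exists_isNode_critEdge (h ν (Nat.lt_succ_self ν))
    have hlt : (ultK A (ν + 1)).ncard < (ultK A ν).ncard :=
      Set.ncard_lt_ncard ((Set.ssubset_iff_of_subset (ultK_succ_subset A ν)).2
        ⟨i, mem_ultK_of_isNode hi, notMem_ultK_succ_of_isNode hi⟩)
    have := ih fun μ hμ => h μ (by omega)
    omega

theorem exists_ultLambda_eq_zero (A : Mat n) : ∃ μ ≤ n, ultLambda A μ = 0 := by
  by_contra! h
  have := ncard_ultK_add_le (A := A) (ν := n + 1) fun μ hμ => h μ (by omega)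
  omega

theorem ultCount_le (A : Mat n) : ultCount A ≤ n := by
  obtain ⟨μ, hμ, h⟩ := exists_ultLambda_eq_zero A
  exact (Nat.sInf_le h).trans hμ

theorem ultLambda_ultCount (A : Mat n) : ultLambda A (ultCount A) = 0 := by
  obtain ⟨μ, hμ, h⟩ := exists_ultLambda_eq_zero A
  exact Nat.sInf_mem (s := {μ | ultLambda A μ = 0}) ⟨μ, h⟩

theorem ultLambda_ne_zero {A : Mat n} {μ : ℕ} (h : μ < ultCount A) : ultLambda A μ ≠ 0 :=
  fun h0 => Nat.notMem_of_lt_sInf h h0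

theorem ultA_le (A : Mat n) (μ : ℕ) (i j : Fin n) : ultA A μ i j ≤ A i j := restrict_le _ _ _ _

theorem ultLambda_succ_lt {A : Mat n} {μ : ℕ} (h : ultLambda A μ ≠ 0) :
    ultLambda A (μ + 1) < ultLambda A μ := by
  have : ultA A (μ + 1) = restrict (ultA A μ) (ultK A (μ + 1)) := by
    funext i j
    by_cases hij : i ∈ ultK A (μ + 1) ∧ j ∈ ultK A (μ + 1)
    · simp [ultA, restrict, hij, ultK_succ_subset A μ hij.1, ultK_succ_subset A μ hij.2]
    · simp only [ultA, restrict, hij, if_false]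
  rw [ultLambda, this]
  exact mcgm_restrict_lt h fun i hi hN => notMem_ultK_succ_of_isNode hN hi

theorem ultLambda_lt {A : Mat n} {μ ν : ℕ} (hμν : μ < ν) (hν : ν ≤ ultCount A) :
    ultLambda A ν < ultLambda A μ := by
  induction ν, hμν using Nat.le_induction with
  | base => exact ultLambda_succ_lt (ultLambda_ne_zero (by omega))
  | succ ν _ ih => exact (ultLambda_succ_lt (ultLambda_ne_zero (by omega))).trans (ih (by omega))

theorem cyclicity_dvd_ultGamma {A : Mat n} {μ : ℕ} (h : μ < ultCount A) :
    cyclicity (CritEdge (ultA A μ)) ∣ ultGamma A :=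
  Finset.dvd_lcm (f := fun μ => cyclicity (CritEdge (ultA A μ))) (Finset.mem_range.2 h)

theorem ultGamma_pos (A : Mat n) : 0 < ultGamma A := by
  rw [Nat.pos_iff_ne_zero, ultGamma, Ne, Finset.lcm_eq_zero_iff]
  rintro ⟨μ, -, h⟩
  exact cyclicity_critEdge_ne_zero _ h

/-- There is a walk from `i` to `j` of length `r` modulo `ultGamma A` through a critical node of
the `ν`-th term. -/
def Visits (A : Mat n) (i j : Fin n) (r ν : ℕ) : Prop :=
  ∃ k a b, IsNode (CritEdge (ultA A ν)) k ∧ mpow A a i k ≠ 0 ∧ mpow A b k j ≠ 0 ∧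
    a + b ≡ r [MOD ultGamma A]

theorem Visits.congr {A : Mat n} {i j : Fin n} {r r' ν : ℕ} (h : Visits A i j r ν)
    (hr : r ≡ r' [MOD ultGamma A]) : Visits A i j r' ν := by
  obtain ⟨k, a, b, hk, ha, hb, hab⟩ := h
  exact ⟨k, a, b, hk, ha, hb, hab.trans hr⟩

theorem Visits.prepend {A : Mat n} {i p j : Fin n} {r s ν : ℕ} (h : Visits A p j r ν)
    (hs : mpow A s i p ≠ 0) : Visits A i j (s + r) ν := by
  obtain ⟨k, a, b, hk, ha, hb, hab⟩ := h
  refine ⟨k, s + a, b, hk, mpow_add_ne_zero hs ha, hb, ?_⟩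
  rw [add_assoc]
  exact hab.add_left s

/-- If `p` had been removed at an earlier step, it would share its component with a critical node
`k` of that step. The round trip from `p` to `k` and back, made `ultGamma A` times, preserves the
residue and yields a forbidden visit. -/
theorem mem_ultK_of_walk {A : Mat n} {i p j : Fin n} {s s' r ν : ℕ}
    (hν : ∀ μ < ν, ¬ Visits A i j r μ) (hs : mpow A s i p ≠ 0) (hs' : mpow A s' p j ≠ 0)
    (hr : s + s' ≡ r [MOD ultGamma A]) : p ∈ ultK A ν := by
  by_contra hp
  obtain ⟨μ, hμ, k, hk, hpk⟩ := exists_isNode_of_notMem_ultK hp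
  rw [SameComp, access_iff, access_iff] at hpk
  obtain ⟨⟨e, he⟩, ⟨f, hf⟩⟩ := hpk
  refine hν μ hμ ⟨k, s + e, f + ((ultGamma A - 1) * (e + f) + s'), hk, mpow_add_ne_zero hs he,
    mpow_add_ne_zero hf (mpow_add_ne_zero (mpow_mul_ne_zero (mpow_add_ne_zero he hf) _) hs'), ?_⟩
  obtain ⟨g, hg⟩ := Nat.exists_eq_add_of_lt (ultGamma_pos A)
  have : s + e + (f + ((ultGamma A - 1) * (e + f) + s')) = s + s' + ultGamma A * (e + f) := by
    rw [hg]; simp only [zero_add, Nat.add_sub_cancel]; ring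
  rw [this]
  refine Nat.ModEq.trans ?_ hr
  simp [Nat.ModEq]

theorem mpow_ultA_eq {A : Mat n} {i j : Fin n} {r ν t : ℕ} (hν : ∀ μ < ν, ¬ Visits A i j r μ)
    (ht : t ≡ r [MOD ultGamma A]) : mpow (ultA A ν) t i j = mpow A t i j :=
  mpow_restrict_eq fun _ _ _ hss hs hs' => mem_ultK_of_walk hν hs hs' (by rwa [hss])

theorem exists_visit_ultA {A : Mat n} {i j : Fin n} {r ν : ℕ} (hν : ∀ μ < ν, ¬ Visits A i j r μ)
    (h : Visits A i j r ν) :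
    ∃ k a b, IsNode (CritEdge (ultA A ν)) k ∧ mpow (ultA A ν) a i k ≠ 0 ∧
      mpow (ultA A ν) b k j ≠ 0 ∧ a + b ≡ r [MOD ultGamma A] := by
  obtain ⟨k, a, b, hk, ha, hb, hab⟩ := h
  refine ⟨k, a, b, hk, ?_, ?_, hab⟩
  · rw [ultA, mpow_restrict_eq]
    · exact ha
    · rintro s s' p rfl hs hs'
      exact mem_ultK_of_walk hν hs (mpow_add_ne_zero hs' hb) (by rwa [← add_assoc])
  · rw [ultA, mpow_restrict_eq]
    · exact hb
    · rintro s s' p rfl hs hs'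
      exact mem_ultK_of_walk hν (mpow_add_ne_zero ha hs) hs' (by rwa [add_assoc])

/-- The number of the term that dominates the entries `(i, j)` of the powers `A ^ t`, `t ≡ r`;
`ultCount A` if these entries ultimately vanish. -/
noncomputable def lead (A : Mat n) (i j : Fin n) (r : ℕ) : ℕ :=
  sInf {ν | ultCount A ≤ ν ∨ Visits A i j r ν}

theorem lead_le (A : Mat n) (i j : Fin n) (r : ℕ) : lead A i j r ≤ ultCount A :=
  Nat.sInf_le (Or.inl le_rfl)

theorem lead_le_of_visits {A : Mat n} {i j : Fin n} {r ν : ℕ} (h : Visits A i j r ν) :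
    lead A i j r ≤ ν := Nat.sInf_le (Or.inr h)

theorem visits_lead {A : Mat n} {i j : Fin n} {r : ℕ} (h : lead A i j r < ultCount A) :
    Visits A i j r (lead A i j r) := by
  have := Nat.sInf_mem (s := {ν | ultCount A ≤ ν ∨ Visits A i j r ν}) ⟨ultCount A, Or.inl le_rfl⟩
  exact this.resolve_left (not_le.2 h)

theorem not_visits_of_lt_lead {A : Mat n} {i j : Fin n} {r : ℕ} :
    ∀ μ < lead A i j r, ¬ Visits A i j r μ :=
  fun _ hμ h => Nat.notMem_of_lt_sInf hμ (Or.inr h)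

theorem lead_prepend {A : Mat n} {i p : Fin n} {s : ℕ} (hs : mpow A s i p ≠ 0) (j : Fin n) {r r' : ℕ}
    (hr : s + r ≡ r' [MOD ultGamma A]) : lead A i j r' ≤ lead A p j r := by
  rcases (lead_le A p j r).lt_or_eq with h | h
  · exact lead_le_of_visits (((visits_lead h).prepend hs).congr hr)
  · rw [h]; exact lead_le A i j r'

/-- No earlier term is visited, so in this residue class the powers of `A` agree with those of the
restricted matrix of the leading term, where the walk through a critical node survives. -/
theorem eventually_mpow_eq_lead {A : Mat n} {i j : Fin n} {r : ℕ} (h : lead A i j r < ultCount A) :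
    ∃ F : ℝ≥0, F ≠ 0 ∧ ∀ᶠ t in Filter.atTop, t ≡ r [MOD ultGamma A] →
      mpow A t i j = F * ultLambda A (lead A i j r) ^ t := by
  obtain ⟨k, a, b, hk, ha, hb, hab⟩ := exists_visit_ultA not_visits_of_lt_lead (visits_lead h)
  obtain ⟨F, hF, hev⟩ := eventually_mpow_eq (ultLambda_ne_zero h) (ultGamma_pos A)
    (cyclicity_dvd_ultGamma h) hk ha hb hab
  refine ⟨F, hF, hev.mono fun t ht htr => ?_⟩
  rw [← mpow_ultA_eq not_visits_of_lt_lead htr]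
  exact ht htr

/-- All walks stay in the part left after the last term, which has no cycles. -/
theorem eventually_mpow_eq_zero {A : Mat n} {i j : Fin n} {r : ℕ} (h : lead A i j r = ultCount A) :
    ∀ᶠ t in Filter.atTop, t ≡ r [MOD ultGamma A] → mpow A t i j = 0 := by
  filter_upwards [Filter.eventually_ge_atTop n] with t ht htr
  rw [← mpow_ultA_eq not_visits_of_lt_lead htr, h]
  exact mpow_eq_zero_of_mcgm_eq_zero (ultLambda_ultCount A) ht i j

/-! Supports of the terms of the expansion -/

theorem ultU_ne_zero_iff {A : Mat n} {ν : ℕ} (h : ν < ultCount A) (i j : Fin n) :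
    ultU A ν 1 i j ≠ 0 ↔ ∃ k a b, IsNode (CritEdge (ultA A ν)) k ∧ mpow (ultA A ν) a i k ≠ 0 ∧
      mpow (ultA A ν) b k j ≠ 0 ∧ a + b ≡ 1 [MOD cyclicity (CritEdge (ultA A ν))] :=
  csr_ne_zero_iff_walk (ultLambda_ne_zero h) i j

theorem visits_of_ultU_ne_zero {A : Mat n} {ν : ℕ} (h : ν < ultCount A) {i j : Fin n}
    (hU : ultU A ν 1 i j ≠ 0) : Visits A i j 1 ν := by
  obtain ⟨k, a, b, hk, ha, hb, hab⟩ := (ultU_ne_zero_iff h i j).1 hU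
  have up := fun t i j => mpow_mono (ultA_le A ν) t i j
  obtain ⟨l₀, hl₀⟩ := exists_crit_loops hk
  obtain ⟨g, hg⟩ := Nat.exists_eq_add_of_lt (ultGamma_pos A)
  rw [zero_add] at hg
  set γ := ultGamma A with hγ
  -- Here `g` is `γ - 1`. A critical loop of length `g * (a + b) + 1 + γ * l₀` brings the total to
  -- `1` modulo `γ`; its length is divisible by the cyclicity of the term because `a + b` is `1`
  -- modulo that cyclicity.
  have e : g * (a + b) + 1 + γ * l₀ + (a + b) = 1 + γ * (a + b + l₀) := by rw [hg]; ring
  have hm : cyclicity (CritEdge (ultA A ν)) ∣ g * (a + b) + 1 + γ * l₀ := by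
    rw [← Nat.modEq_zero_iff_dvd]
    refine Nat.ModEq.add_right_cancel' (a + b) ?_
    rw [e, zero_add]
    refine Nat.ModEq.trans ?_ hab.symm
    refine Nat.ModEq.of_dvd (cyclicity_dvd_ultGamma h) ?_
    simp [Nat.ModEq, ← hγ]
  have hloop := hl₀ _ (by nlinarith [ultGamma_pos A]) hm
  refine ⟨k, a, g * (a + b) + 1 + γ * l₀ + b, hk, ne_zero_of_le (up _ _ _) ha,
    mpow_add_ne_zero (ne_zero_of_le (up _ _ _) (crit_walk_ne_zero hloop))
      (ne_zero_of_le (up _ _ _) hb), ?_⟩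
  rw [show a + (g * (a + b) + 1 + γ * l₀ + b) = 1 + γ * (a + b + l₀) by rw [← e]; ring, ← hγ]
  simp [Nat.ModEq]

theorem ultU_ne_zero_of_visits {A : Mat n} {ν : ℕ} (h : ν < ultCount A) {i j : Fin n}
    (hν : ∀ μ < ν, ¬ Visits A i j 1 μ) (hv : Visits A i j 1 ν) : ultU A ν 1 i j ≠ 0 := by
  obtain ⟨k, a, b, hk, ha, hb, hab⟩ := exists_visit_ultA hν hv
  exact (ultU_ne_zero_iff h i j).2 ⟨k, a, b, hk, ha, hb, hab.of_dvd (cyclicity_dvd_ultGamma h)⟩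

/-- A nonzero entry of `ultU` always gives a visit. The converse holds at the first visited term,
whose walks survive the restriction, and that is enough for the minima to agree. -/
theorem lead_one_eq (A : Mat n) (i j : Fin n) :
    lead A i j 1 = sInf {ν | ultCount A ≤ ν ∨ ultU A ν 1 i j ≠ 0} := by
  set g := sInf {ν | ultCount A ≤ ν ∨ ultU A ν 1 i j ≠ 0} with hg
  have hgm : ultCount A ≤ g ∨ ultU A g 1 i j ≠ 0 :=
    Nat.sInf_mem (s := {ν | ultCount A ≤ ν ∨ ultU A ν 1 i j ≠ 0}) ⟨ultCount A, Or.inl le_rfl⟩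
  apply le_antisymm
  · rcases lt_or_ge g (ultCount A) with h | h
    · exact lead_le_of_visits (visits_of_ultU_ne_zero h (hgm.resolve_left (not_le.2 h)))
    · exact (lead_le A i j 1).trans h
  · rcases (lead_le A i j 1).lt_or_eq with h | h
    · exact Nat.sInf_le (Or.inr (ultU_ne_zero_of_visits h not_visits_of_lt_lead (visits_lead h)))
    · rw [h]; exact Nat.sInf_le (Or.inl le_rfl)

/-! Orbit periodicity -/

/-- Walks through a critical node can be shortened or extended at their start so that their
length becomes `1` modulo `ultGamma A`. -/
theorem exists_shift {A : Mat n} {ν : ℕ} (h : ν < ultCount A) {p : Fin n}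
    (hp : IsNode (CritEdge (ultA A ν)) p) (r : ℕ) :
    ∃ q u w, mpow A w p q ≠ 0 ∧ mpow A u q p ≠ 0 ∧ w + 1 ≡ r [MOD ultGamma A] ∧
      u + r ≡ 1 [MOD ultGamma A] := by
  obtain ⟨l₀, hl₀⟩ := exists_crit_loops hp
  obtain ⟨g, hg⟩ := Nat.exists_eq_add_of_lt (ultGamma_pos A)
  -- A long critical loop, of length divisible by `ultGamma A`, is cut after `r + g` steps with `g =
  -- ultGamma A - 1`; `q` is the node reached.
  have hloop := hl₀ (ultGamma A * (r + g + l₀)) (by nlinarith [ultGamma_pos A])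
    ((cyclicity_dvd_ultGamma h).mul_right _)
  have hle : r + g ≤ ultGamma A * (r + g + l₀) := by nlinarith [ultGamma_pos A]
  obtain ⟨q, hq₁, hq₂⟩ := exists_split hle
    (ne_zero_of_le (mpow_mono (ultA_le A ν) _ _ _) (crit_walk_ne_zero hloop))
  refine ⟨q, _, _, hq₁, hq₂, ?_, ?_⟩
  · rw [show r + g + 1 = r + ultGamma A by omega]
    simp [Nat.ModEq]
  · apply Nat.ModEq.add_right_cancel' g
    rw [show ultGamma A * (r + g + l₀) - (r + g) + r + g = ultGamma A * (r + g + l₀) by omega,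
      show 1 + g = ultGamma A by omega]
    simp [Nat.ModEq]

theorem mvec_eq_zero {A : Mat n} {y : Fin n → ℝ≥0} {i : Fin n} (h : ∀ j, y j ≠ 0 → A i j = 0) :
    mvec A y i = 0 := by
  refine (Finset.sup_eq_bot_iff _ _).2 fun j _ => ?_
  change A i j * y j = 0
  by_cases hj : y j = 0
  · simp [hj]
  · simp [h j hj]

theorem eventually_mvec_eq_zero {A : Mat n} {y : Fin n → ℝ≥0} {i : Fin n} {r : ℕ}
    (h : ∀ j, y j ≠ 0 → lead A i j r = ultCount A) :
    ∀ᶠ t in Filter.atTop, t ≡ r [MOD ultGamma A] → mvec (mpow A t) y i = 0 := by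
  have : ∀ j, ∀ᶠ t in Filter.atTop, y j ≠ 0 → t ≡ r [MOD ultGamma A] → mpow A t i j = 0 := by
    intro j
    by_cases hj : y j = 0
    · simp [hj]
    · exact (eventually_mpow_eq_zero (h j hj)).mono fun t ht _ => ht
  filter_upwards [Filter.eventually_all.2 this] with t ht htr
  exact mvec_eq_zero fun j hj => ht j hj htr

/-- Along a residue class, the entries of an orbit are ultimately geometric. -/
theorem eventually_mvec_eq {A : Mat n} {y : Fin n → ℝ≥0} {i : Fin n} {r v : ℕ}
    (hv : v < ultCount A) (hmem : ∃ j, y j ≠ 0 ∧ lead A i j r = v)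
    (hmin : ∀ j, y j ≠ 0 → v ≤ lead A i j r) :
    ∃ F : ℝ≥0, F ≠ 0 ∧ ∀ᶠ t in Filter.atTop, t ≡ r [MOD ultGamma A] →
      mvec (mpow A t) y i = F * ultLambda A v ^ t := by
  classical
  have hF : ∀ j, ∃ F : ℝ≥0, F ≠ 0 ∧ (y j ≠ 0 → lead A i j r = v →
      ∀ᶠ t in Filter.atTop, t ≡ r [MOD ultGamma A] → mpow A t i j = F * ultLambda A v ^ t) := by
    intro j
    by_cases hj : lead A i j r = v
    · obtain ⟨F, hF, hev⟩ := eventually_mpow_eq_lead (hj.trans_lt hv)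
      rw [hj] at hev
      exact ⟨F, hF, fun _ _ => hev⟩
    · exact ⟨1, one_ne_zero, fun _ h => absurd h hj⟩
  choose F hF0 hFev using hF
  let S : Finset (Fin n) := Finset.univ.filter fun j => y j ≠ 0 ∧ lead A i j r = v
  have hS : S.Nonempty := by
    obtain ⟨j, hj⟩ := hmem
    exact ⟨j, by simpa [S] using hj⟩
  obtain ⟨j₀, hj₀, hsup⟩ := Finset.exists_mem_eq_sup S hS fun j => F j * y j
  obtain ⟨hy₀, hl₀⟩ : y j₀ ≠ 0 ∧ lead A i j₀ r = v := (Finset.mem_filter.1 hj₀).2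
  set G := F j₀ * y j₀ with hG
  have hG0 : G ≠ 0 := mul_ne_zero (hF0 j₀) hy₀
  -- Columns with a later lead have a smaller rate or vanish; those with lead `v` are bounded by the
  -- best coefficient `G`.
  have upper : ∀ j, ∀ᶠ t in Filter.atTop, t ≡ r [MOD ultGamma A] →
      mpow A t i j * y j ≤ G * ultLambda A v ^ t := by
    intro j
    by_cases hj : y j = 0
    · simp [hj]
    rcases (hmin j hj).lt_or_eq with hlt | heq
    · rcases (lead_le A i j r).lt_or_eq with hc | hc
      · obtain ⟨F', -, hev⟩ := eventually_mpow_eq_lead hc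
        filter_upwards [hev, eventually_mul_pow_le (F' * y j)
          (ultLambda_lt hlt (lead_le A i j r)) hG0] with t ht ht' htr
        rw [ht htr]
        refine le_trans (le_of_eq ?_) ht'
        ring
      · filter_upwards [eventually_mpow_eq_zero hc] with t ht htr
        simp [ht htr]
    · filter_upwards [hFev j hj heq.symm] with t ht htr
      rw [ht htr, mul_right_comm]
      refine mul_le_mul_left ?_ _
      rw [← hsup]
      exact Finset.le_sup (f := fun j => F j * y j) (by simpa [S, hj] using heq.symm)
  refine ⟨G, hG0, ?_⟩
  filter_upwards [Filter.eventually_all.2 upper, hFev j₀ hy₀ hl₀] with t ht ht₀ htr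
  apply le_antisymm
  · exact Finset.sup_le fun j _ => ht j htr
  · refine le_trans (le_of_eq ?_)
      (Finset.le_sup (f := fun j => mpow A t i j * y j) (Finset.mem_univ j₀))
    simp only [ht₀ htr]
    rw [hG]
    ring

/-- Let `v` be the least lead over all rows, all residues and the support of `y`. A row and residue
that does not ultimately vanish but has only larger leads would contradict `H`, once both rows are
replaced by rows with the same leads at residue `1`. So every nonvanishing entry has rate `ultLambda
A v`. -/
theorem orbitPeriodic_of_lead {A : Mat n}
    (H : ∀ i i' j k, lead A i' j 1 < lead A i k 1 → lead A i k 1 < ultCount A →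
      lead A i j 1 ≤ lead A i' j 1) : OrbitPeriodic A := by
  intro y
  set γ := ultGamma A with hγ
  suffices h : ∃ l : ℝ≥0, ∀ i, ∀ r < γ, ∀ᶠ t in Filter.atTop, t ≡ r [MOD γ] →
      mvec (mpow A (t + γ)) y i = l ^ γ * mvec (mpow A t) y i by
    obtain ⟨l, hl⟩ := h
    refine ⟨l, ?_⟩
    have : ∀ i, ∀ᶠ t in Filter.atTop, ∀ r ∈ Finset.range γ, t ≡ r [MOD γ] →
        mvec (mpow A (t + γ)) y i = l ^ γ * mvec (mpow A t) y i := fun i =>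
      (Filter.eventually_all_finset _).2 fun r hr => hl i r (Finset.mem_range.1 hr)
    filter_upwards [Filter.eventually_all.2 this] with t ht
    funext i
    exact ht i (t % γ) (Finset.mem_range.2 (Nat.mod_lt _ (ultGamma_pos A))) (Nat.mod_modEq t γ).symm
  have hshift : ∀ {p : ℕ → Prop}, (∀ᶠ t in Filter.atTop, p t) → ∀ᶠ t in Filter.atTop, p (t + γ) :=
    fun h => (Filter.tendsto_add_atTop_nat γ).eventually h
  have hmod : ∀ {t r : ℕ}, t ≡ r [MOD γ] → t + γ ≡ r [MOD γ] := fun h => by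
    simpa [Nat.ModEq] using h
  have hzero : ∀ (l : ℝ≥0) (i : Fin n) (r : ℕ), (∀ j, y j ≠ 0 → lead A i j r = ultCount A) →
      ∀ᶠ t in Filter.atTop, t ≡ r [MOD γ] →
        mvec (mpow A (t + γ)) y i = l ^ γ * mvec (mpow A t) y i := by
    intro l i r h
    have hev := eventually_mvec_eq_zero h
    filter_upwards [hev, hshift hev] with t h₁ h₂ htr
    rw [h₁ htr, h₂ (hmod htr), mul_zero]
  by_cases hall : ∀ i j r, y j ≠ 0 → lead A i j r = ultCount A
  · exact ⟨0, fun i r _ => hzero 0 i r fun j hj => hall i j r hj⟩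
  push Not at hall
  obtain ⟨i₁, j₁, r₁, hy₁, hl₁⟩ := hall
  let V : Set ℕ := {v | ∃ i j r, y j ≠ 0 ∧ lead A i j r = v}
  obtain ⟨i₀, j₀, r₀, hy₀, hv⟩ : sInf V ∈ V := Nat.sInf_mem ⟨_, i₁, j₁, r₁, hy₁, rfl⟩
  have hVmin : ∀ i j r, y j ≠ 0 → lead A i₀ j₀ r₀ ≤ lead A i j r := fun i j r hj => by
    rw [hv]; exact Nat.sInf_le ⟨i, j, r, hj, rfl⟩
  set v := lead A i₀ j₀ r₀ with hv'
  have hvm : v < ultCount A :=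
    (hVmin i₁ j₁ r₁ hy₁).trans_lt (lt_of_le_of_ne (lead_le _ _ _ _) hl₁)
  refine ⟨ultLambda A v, fun i r _ => ?_⟩
  by_cases hk : ∀ j, y j ≠ 0 → lead A i j r = ultCount A
  · exact hzero _ i r hk
  suffices hmem : ∃ j, y j ≠ 0 ∧ lead A i j r = v by
    obtain ⟨F, -, hev⟩ := eventually_mvec_eq hvm hmem fun j hj => hVmin i j r hj
    filter_upwards [hev, hshift hev] with t h₁ h₂ htr
    rw [h₁ htr, h₂ (hmod htr)]
    ring
  by_contra hne
  push Not at hk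
  obtain ⟨k₁, hyk₁, hlk₁⟩ := hk
  let W : Set ℕ := {w | ∃ k, y k ≠ 0 ∧ lead A i k r = w}
  obtain ⟨k, hyk, hw⟩ : sInf W ∈ W := Nat.sInf_mem ⟨_, k₁, hyk₁, rfl⟩
  have hWmin : ∀ j, y j ≠ 0 → lead A i k r ≤ lead A i j r := fun j hj => by
    rw [hw]; exact Nat.sInf_le ⟨j, hj, rfl⟩
  have hkm : lead A i k r < ultCount A :=
    (hWmin k₁ hyk₁).trans_lt (lt_of_le_of_ne (lead_le _ _ _ _) hlk₁)
  have hvk : v < lead A i k r :=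
    lt_of_le_of_ne (hVmin i k r hyk) fun h => hne ⟨k, hyk, h.symm⟩
  -- Move both entries to the residue `1`.
  have key : ∀ {i j r}, lead A i j r < ultCount A → ∃ q s, mpow A s i q ≠ 0 ∧
      s + 1 ≡ r [MOD γ] ∧ lead A q j 1 = lead A i j r := by
    intro i j r h
    obtain ⟨p, a, b, hp, ha, hb, hab⟩ := visits_lead h
    obtain ⟨q, u, w, hw, hu, hwr, hur⟩ := exists_shift h hp b
    have hs := mpow_add_ne_zero ha hw
    have hsr : a + w + 1 ≡ r [MOD γ] := by
      rw [add_assoc]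
      exact (hwr.add_left a).trans hab
    refine ⟨q, a + w, hs, hsr, le_antisymm ?_ (lead_prepend hs j hsr)⟩
    exact lead_le_of_visits ⟨p, u, b, hp, hu, hb, hur⟩
  obtain ⟨q, s, hs, hsr, hq⟩ := key hkm
  obtain ⟨q', s', -, -, hq'⟩ := key (hv' ▸ hvm)
  -- The criterion gives column `j₀` a lead of at most `v` in row `q`; prepending the walk from `i`
  -- to `q` carries this back to row `i`, where all leads were assumed larger.
  have h₁ := H q q' j₀ k (by rw [hq, hq']; exact hvk) (by rw [hq]; exact hkm)
  rw [hq'] at h₁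
  have h₂ : lead A i j₀ r ≤ lead A q j₀ 1 := lead_prepend hs j₀ hsr
  exact absurd ((hWmin j₀ hy₀).trans (h₂.trans h₁)) (not_le.2 hvk)

/-- For the indicator vector of `j` and `k`, a violation gives rows `i` and `i'` different rates
along residue `1`, both nonzero, so no single `l` fits. -/
theorem lead_of_orbitPeriodic {A : Mat n} (hA : OrbitPeriodic A) {i i' j k : Fin n}
    (h₁ : lead A i' j 1 < lead A i k 1) (h₂ : lead A i k 1 < ultCount A) :
    lead A i j 1 ≤ lead A i' j 1 := by
  classical
  by_contra! h₃
  set γ := ultGamma A with hγ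
  let y : Fin n → ℝ≥0 := fun x => if x = j ∨ x = k then 1 else 0
  have hy : ∀ x, y x ≠ 0 ↔ x = j ∨ x = k := fun x => by simp [y, or_iff_not_imp_left]
  obtain ⟨l, hl⟩ := hA y
  have key : ∀ i, min (lead A i j 1) (lead A i k 1) < ultCount A →
      l ^ γ = ultLambda A (min (lead A i j 1) (lead A i k 1)) ^ γ := by
    intro i hi
    have hmem : ∃ x, y x ≠ 0 ∧ lead A i x 1 = min (lead A i j 1) (lead A i k 1) := by
      rcases min_choice (lead A i j 1) (lead A i k 1) with h | h
      · exact ⟨j, (hy j).2 (Or.inl rfl), h.symm⟩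
      · exact ⟨k, (hy k).2 (Or.inr rfl), h.symm⟩
    obtain ⟨F, hF, hev⟩ := eventually_mvec_eq hi hmem fun x hx => by
      rcases (hy x).1 hx with rfl | rfl
      · exact min_le_left _ _
      · exact min_le_right _ _
    obtain ⟨T, hT⟩ := Filter.eventually_atTop.1 (hl.and hev)
    have hγ0 : 0 < γ := ultGamma_pos A
    have hTle : T ≤ 1 + γ * T := by nlinarith
    -- A late time in residue class `1`, compared below with the next time in that class.
    obtain ⟨e₁, e₂⟩ := hT (1 + γ * T) hTle
    obtain ⟨-, e₃⟩ := hT (1 + γ * T + γ) (by omega)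
    have e₁' := congrFun e₁ i
    simp only [Pi.smul_apply, smul_eq_mul, ← hγ] at e₁'
    rw [e₂ (by simp [Nat.ModEq, ← hγ]), e₃ (by simp [Nat.ModEq, ← hγ]), pow_add _ _ γ,
      ← mul_assoc, mul_comm (l ^ γ)] at e₁'
    exact (mul_left_cancel₀ (mul_ne_zero hF (pow_ne_zero _ (ultLambda_ne_zero hi))) e₁').symm
  have e := (key i (by omega)).symm.trans (key i' (by omega))
  refine absurd e (ne_of_lt (pow_lt_pow_left₀ (ultLambda_lt ?_ ?_) zero_le (ultGamma_pos A).ne'))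
  · omega
  · exact (min_le_right _ _).trans (lead_le A i k 1)

theorem orbitPeriodic_iff (A : Mat n) :
    OrbitPeriodic A ↔ ∀ i i' j k, lead A i' j 1 < lead A i k 1 → lead A i k 1 < ultCount A →
      lead A i j 1 ≤ lead A i' j 1 :=
  ⟨fun h _ _ _ _ h₁ h₂ => lead_of_orbitPeriodic h h₁ h₂, orbitPeriodic_of_lead⟩

end MaxAlg

namespace RAM

/-! Total correctness with time bounds -/

/-- Started in `s`, the program `p` halts after at most `B` steps in a state satisfying `Q`. -/
def Runs (p : Prog) (s : State) (B : ℕ) (Q : State → Prop) : Prop :=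
  ∃ s' T, Exec p s s' T ∧ T ≤ B ∧ Q s'

theorem Runs.weaken {p : Prog} {s : State} {B B' : ℕ} {Q Q' : State → Prop} (h : Runs p s B Q)
    (hB : B ≤ B') (hQ : ∀ s', Q s' → Q' s') : Runs p s B' Q' := by
  obtain ⟨s', T, he, hT, hq⟩ := h
  exact ⟨s', T, he, hT.trans hB, hQ s' hq⟩

theorem Runs.skip {s : State} {Q : State → Prop} (h : Q s) : Runs .skip s 1 Q :=
  ⟨s, 1, .skip s, le_rfl, h⟩

theorem Runs.op {o : Op} {s : State} {Q : State → Prop} (h : Q (o.run s)) : Runs (.op o) s 1 Q :=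
  ⟨_, 1, .op o s, le_rfl, h⟩

theorem Runs.seq {p q : Prog} {s : State} {B B' : ℕ} {Q : State → Prop}
    (h : Runs p s B fun s' => Runs q s' B' Q) : Runs (.seq p q) s (B + B') Q := by
  obtain ⟨s', T, he, hT, s'', T', he', hT', hq⟩ := h
  exact ⟨s'', T + T', .seq he he', add_le_add hT hT', hq⟩

theorem Runs.ite {b : Test} {p q : Prog} {s : State} {B : ℕ} {Q : State → Prop}
    (h₁ : b.Holds s → Runs p s B Q) (h₂ : ¬ b.Holds s → Runs q s B Q) :
    Runs (.ite b p q) s (B + 1) Q := by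
  by_cases hb : b.Holds s
  · obtain ⟨s', T, he, hT, hq⟩ := h₁ hb
    exact ⟨s', T + 1, .ite_true hb he, by omega, hq⟩
  · obtain ⟨s', T, he, hT, hq⟩ := h₂ hb
    exact ⟨s', T + 1, .ite_false hb he, by omega, hq⟩

/-- `for r = 0, …, (content of register b) - 1 do body`. -/
def forLoop (r b : ℕ) (body : Prog) : Prog :=
  .seq (.op (.constI r 0)) (.loop (.ltI r b) (.seq body (.op (.succI r))))

/-- The invariant is required after the increment. Each round costs one test and one increment
beyond the body; the final `2` counts the initialization and the failing test. -/
theorem Runs.forLoop {r b : ℕ} {body : Prog} {s : State} {N B : ℕ} (I : ℕ → State → Prop)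
    (h0 : I 0 (s.setI r 0)) (hI : ∀ k s, I k s → s.ireg r = k ∧ s.ireg b = N)
    (hbody : ∀ k < N, ∀ s, I k s →
      Runs body s B fun s' => I (k + 1) (s'.setI r (s'.ireg r + 1))) :
    Runs (forLoop r b body) s (N * (B + 2) + 2) (I N) := by
  have key : ∀ d k s, k + d = N → I k s →
      Runs (.loop (.ltI r b) (.seq body (.op (.succI r)))) s (d * (B + 2) + 1) (I N) := by
    intro d
    induction d with
    | zero =>
      rintro k s rfl hk
      refine ⟨s, 1, .loop_done ?_, by omega, hk⟩
      have := hI k s hk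
      simp only [Test.Holds]
      omega
    | succ d ih =>
      intro k s hkd hk
      obtain ⟨s', T, he, hT, hq⟩ := hbody k (by omega) s hk
      obtain ⟨s'', T', he', hT', hq'⟩ := ih (k + 1) _ (by omega) hq
      refine ⟨s'', T + 1 + T' + 1, .loop_step ?_ (.seq he (.op _ _)) he', ?_, hq'⟩
      · have := hI k s hk
        simp only [Test.Holds]
        omega
      · rw [Nat.succ_mul]; omega
  have h := key N 0 _ (by omega) h0
  exact (Runs.seq (Runs.op (o := .constI r 0) h)).weaken (by omega) fun _ h => h

/-! ### Tabulating the leading terms and the column minima -/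

/-- Minimum of `m` and the values `f 0, …, f (k - 1)`. -/
def minUpTo (f : ℕ → ℕ) (m : ℕ) : ℕ → ℕ
  | 0 => m
  | k + 1 => min (minUpTo f m k) (f k)

theorem minUpTo_lt_iff (f : ℕ → ℕ) (m k x : ℕ) :
    minUpTo f m k < x ↔ m < x ∨ ∃ ν < k, f ν < x := by
  induction k with
  | zero => simp [minUpTo]
  | succ k ih =>
    rw [minUpTo, min_lt_iff, ih, or_assoc]
    simp only [Nat.exists_lt_succ_right]

open Classical in
/-- The least `ν < m` with `u ν i j ≠ 0`, or `m` if there is none. -/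
noncomputable def leadNum (u : ℕ → ℕ → ℕ → ℝ≥0) (m i j : ℕ) : ℕ :=
  minUpTo (fun ν => if u ν i j = 0 then m else ν) m m

/-- Computes `leadNum` of array `2` at the indices in registers `5` and `6` into register `8`. -/
def leadProg : Prog :=
  .seq (.op (.copyI 8 2)) (forLoop 7 2
    (.seq (.op (.loadR 1 2 7 5 6)) (.ite (.eqR 1 0) .skip
      (.ite (.ltI 7 8) (.op (.copyI 8 7)) .skip))))

theorem runs_leadProg (s : State) (h0 : s.rreg 0 = 0) :
    Runs leadProg s (s.ireg 2 * 6 + 3) fun s' => s'.iarr = s.iarr ∧ s'.rarr = s.rarr ∧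
      s'.rreg 0 = 0 ∧ (∀ r, r ≠ 7 → r ≠ 8 → s'.ireg r = s.ireg r) ∧
      s'.ireg 8 = leadNum (s.rarr 2) (s.ireg 2) (s.ireg 5) (s.ireg 6) := by
  classical
  refine (Runs.seq (Runs.op (Runs.forLoop (B := 4) (N := s.ireg 2) (fun k s' =>
    s'.iarr = s.iarr ∧ s'.rarr = s.rarr ∧ s'.rreg 0 = 0 ∧
      (∀ r, r ≠ 7 → r ≠ 8 → s'.ireg r = s.ireg r) ∧ s'.ireg 7 = k ∧
      s'.ireg 8 = minUpTo (fun ν => if s.rarr 2 ν (s.ireg 5) (s.ireg 6) = 0 then s.ireg 2 else ν)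
        (s.ireg 2) k) ?_ ?_ ?_))).weaken (by omega) ?_
  · refine ⟨rfl, rfl, h0, ?_, ?_, ?_⟩
    · intro r h₁ h₂
      simp [Op.run, State.setI, h₁, h₂]
    · simp [State.setI]
    · simp [Op.run, State.setI, minUpTo]
  · rintro k s' ⟨-, -, -, h, h', -⟩
    exact ⟨h', h 2 (by decide) (by decide)⟩
  · rintro k hk s' ⟨h₁, h₂, h₃, h₄, h₅, h₆⟩
    refine (Runs.seq (Runs.op (Runs.ite (B := 2) ?_ ?_))).weaken (B := 4) (by omega) fun _ h => h
    · intro hb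
      have hb' : s.rarr 2 k (s.ireg 5) (s.ireg 6) = 0 := by
        simpa [Test.Holds, Op.run, State.setR, h₂, h₃, h₅, h₄] using hb
      refine (Runs.skip ?_).weaken (B' := 2) (by omega) fun _ h => h
      refine ⟨h₁, h₂, ?_, ?_, ?_, ?_⟩
      · simpa [Op.run, State.setI, State.setR] using h₃
      · intro r e₁ e₂
        simpa [Op.run, State.setI, State.setR, e₁, e₂] using h₄ r e₁ e₂
      · simpa [Op.run, State.setI, State.setR] using h₅
      · simp only [Op.run, State.setI, State.setR, minUpTo, hb', if_true]
        rw [Function.update_of_ne (by decide), h₆, eq_comm, min_eq_left_iff]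
        -- A zero entry contributes the default `m`, which cannot lower a running minimum that
        -- started at `m`.
        by_contra hlt
        rw [not_le, ← h₆] at hlt
        have h₇ := (minUpTo_lt_iff (fun ν => if s.rarr 2 ν (s.ireg 5) (s.ireg 6) = 0 then s.ireg 2
          else ν) (s.ireg 2) k (s.ireg 2 + 1)).2 (Or.inl (by omega))
        omega
    · intro hb
      have hb' : s.rarr 2 k (s.ireg 5) (s.ireg 6) ≠ 0 := by
        simpa [Test.Holds, Op.run, State.setR, h₂, h₃, h₅, h₄] using hb
      refine Runs.ite (B := 1) ?_ ?_
      · intro hb₂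
        have hb₂' : k < s'.ireg 8 := by
          simpa [Test.Holds, Op.run, State.setR, h₅] using hb₂
        refine Runs.op ⟨h₁, h₂, ?_, ?_, ?_, ?_⟩
        · simpa [Op.run, State.setI, State.setR] using h₃
        · intro r e₁ e₂
          simpa [Op.run, State.setI, State.setR, e₁, e₂] using h₄ r e₁ e₂
        · simpa [Op.run, State.setI, State.setR] using h₅
        · simp only [Op.run, State.setI, State.setR, minUpTo, hb', if_false]
          rw [Function.update_of_ne (by decide), Function.update_self, h₅, ← h₆,
            min_eq_right hb₂'.le]
      · intro hb₂
        have hb₂' : s'.ireg 8 ≤ k := by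
          simpa [Test.Holds, Op.run, State.setR, h₅] using hb₂
        refine Runs.skip ⟨h₁, h₂, ?_, ?_, ?_, ?_⟩
        · simpa [Op.run, State.setI, State.setR] using h₃
        · intro r e₁ e₂
          simpa [Op.run, State.setI, State.setR, e₁, e₂] using h₄ r e₁ e₂
        · simpa [Op.run, State.setI, State.setR] using h₅
        · simp only [Op.run, State.setI, State.setR, minUpTo, hb', if_false]
          rw [Function.update_of_ne (by decide), ← h₆, min_eq_left hb₂']
  · rintro s' ⟨h₁, h₂, h₃, h₄, -, h₆⟩
    exact ⟨h₁, h₂, h₃, h₄, h₆⟩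

/-- Computes the numbers `leadNum` for the column in register `6` and their minimum. -/
def columnProg : Prog :=
  .seq (.op (.copyI 9 2)) (.seq
    (forLoop 5 0 (.seq leadProg (.seq (.op (.storeI 2 5 6 8))
      (.ite (.ltI 8 9) (.op (.copyI 9 8)) .skip))))
    (.op (.storeI 3 6 4 9)))

theorem runs_columnProg (s : State) (h0 : s.rreg 0 = 0) (h4 : s.ireg 4 = 0) :
    Runs columnProg s (s.ireg 0 * (s.ireg 2 * 6 + 8) + 4) fun s' => s'.rarr = s.rarr ∧
      s'.rreg 0 = 0 ∧ (∀ r, r ≠ 5 → r ≠ 7 → r ≠ 8 → r ≠ 9 → s'.ireg r = s.ireg r) ∧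
      (∀ p < s.ireg 0, s'.iarr 2 p (s.ireg 6) = leadNum (s.rarr 2) (s.ireg 2) p (s.ireg 6)) ∧
      (∀ p q, q ≠ s.ireg 6 → s'.iarr 2 p q = s.iarr 2 p q) ∧
      s'.iarr 3 (s.ireg 6) 0 =
        minUpTo (fun p => leadNum (s.rarr 2) (s.ireg 2) p (s.ireg 6)) (s.ireg 2) (s.ireg 0) ∧
      (∀ p, p ≠ s.ireg 6 → s'.iarr 3 p 0 = s.iarr 3 p 0) := by
  set G := fun p => leadNum (s.rarr 2) (s.ireg 2) p (s.ireg 6) with hG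
  refine (Runs.seq (Runs.op (Runs.seq ((Runs.forLoop (B := s.ireg 2 * 6 + 6) (N := s.ireg 0)
    (fun k s' => s'.rarr = s.rarr ∧ s'.rreg 0 = 0 ∧
      (∀ r, r ≠ 5 → r ≠ 7 → r ≠ 8 → r ≠ 9 → s'.ireg r = s.ireg r) ∧ s'.ireg 5 = k ∧
      s'.ireg 9 = minUpTo G (s.ireg 2) k ∧
      (∀ p < k, s'.iarr 2 p (s.ireg 6) = G p) ∧
      (∀ p q, q ≠ s.ireg 6 → s'.iarr 2 p q = s.iarr 2 p q) ∧ s'.iarr 3 = s.iarr 3)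
    ?_ ?_ ?_).weaken le_rfl ?_)))).weaken (B := 1 + (s.ireg 0 * (s.ireg 2 * 6 + 8) + 2 + 1))
    (by omega) fun _ h => h
  · refine ⟨rfl, h0, ?_, ?_, ?_, ?_, fun _ _ _ => rfl, rfl⟩
    · intro r h₁ h₂ h₃ h₄
      simp [Op.run, State.setI, h₁, h₄]
    · simp [State.setI]
    · simp [Op.run, State.setI, minUpTo]
    · intro p hp
      omega
  · rintro k s' ⟨-, -, h, h', -⟩
    exact ⟨h', h 0 (by decide) (by decide) (by decide) (by decide)⟩
  · rintro k hk s' ⟨h₁, h₂, h₃, h₄, h₅, h₆, h₇, h₈⟩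
    refine (Runs.seq ((runs_leadProg s' h₂).weaken le_rfl ?_)).weaken
      (B := s'.ireg 2 * 6 + 3 + 3) ?_ fun _ h => h
    · rintro s₁ ⟨e₁, e₂, e₃, e₄, e₅⟩
      have f5 : s₁.ireg 5 = k := (e₄ 5 (by decide) (by decide)).trans h₄
      have f6 : s₁.ireg 6 = s.ireg 6 := (e₄ 6 (by decide) (by decide)).trans
        (h₃ 6 (by decide) (by decide) (by decide) (by decide))
      have f9 : s₁.ireg 9 = minUpTo G (s.ireg 2) k := (e₄ 9 (by decide) (by decide)).trans h₅
      have f8 : s₁.ireg 8 = G k := by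
        rw [e₅, h₁, h₄, h₃ 2 (by decide) (by decide) (by decide) (by decide),
          h₃ 6 (by decide) (by decide) (by decide) (by decide)]
      have arr : ∀ p < k + 1, (Op.run (.storeI 2 5 6 8) s₁).iarr 2 p (s.ireg 6) = G p := by
        intro p hp
        simp only [Op.run, f5, f6, f8, true_and, and_true]
        split_ifs with hpk
        · rw [hpk]
        · rw [e₁]; exact h₆ p (by omega)
      have arr' : ∀ p q, q ≠ s.ireg 6 →
          (Op.run (.storeI 2 5 6 8) s₁).iarr 2 p q = s.iarr 2 p q := by
        intro p q hq
        simp only [Op.run, f6, hq, and_false, if_false]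
        rw [e₁]; exact h₇ p q hq
      have arr3 : (Op.run (.storeI 2 5 6 8) s₁).iarr 3 = s.iarr 3 := by
        rw [← h₈, ← e₁]
        rfl
      have regs : ∀ r, r ≠ 5 → r ≠ 7 → r ≠ 8 → r ≠ 9 → s₁.ireg r = s.ireg r :=
        fun r a b c d => (e₄ r b c).trans (h₃ r a b c d)
      refine Runs.seq (B' := 2) (Runs.op (Runs.ite (B := 1) ?_ ?_))
      · intro hb
        have hb' : G k < minUpTo G (s.ireg 2) k := by
          simpa [Test.Holds, Op.run, f8, f9] using hb
        refine Runs.op ⟨e₂.trans h₁, e₃, ?_, ?_, ?_, arr, arr', arr3⟩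
        · intro r a b c d
          simpa [Op.run, State.setI, a, d] using regs r a b c d
        · simp [Op.run, State.setI, f5]
        · simp [Op.run, State.setI, minUpTo, f8, hb'.le]
      · intro hb
        have hb' : minUpTo G (s.ireg 2) k ≤ G k := by
          simpa [Test.Holds, Op.run, f8, f9] using hb
        refine Runs.skip ⟨e₂.trans h₁, e₃, ?_, ?_, ?_, arr, arr', arr3⟩
        · intro r a b c d
          simpa [Op.run, State.setI, a, d] using regs r a b c d
        · simp [Op.run, State.setI, f5]
        · simp [Op.run, State.setI, minUpTo, f9, hb']
    · rw [h₃ 2 (by decide) (by decide) (by decide) (by decide)]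
  · rintro s' ⟨h₁, h₂, h₃, h₄, h₅, h₆, h₇, h₈⟩
    have f4 := h₃ 4 (by decide) (by decide) (by decide) (by decide)
    have f6 := h₃ 6 (by decide) (by decide) (by decide) (by decide)
    rw [h4] at f4
    refine Runs.op ⟨h₁, h₂, h₃, h₆, h₇, ?_, ?_⟩
    · simp [Op.run, f4, f6, h₅]
    · intro p hp
      simp [Op.run, f6, hp, h₈]

/-- Computes all numbers `leadNum` and the minima over the columns. -/
def tableProg : Prog := forLoop 6 0 columnProg

theorem runs_tableProg (s : State) (h0 : s.rreg 0 = 0) (h4 : s.ireg 4 = 0) :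
    Runs tableProg s (s.ireg 0 * (s.ireg 0 * (s.ireg 2 * 6 + 8) + 6) + 2) fun s' =>
      (∀ r < 5, s'.ireg r = s.ireg r) ∧
      (∀ q < s.ireg 0, (∀ p < s.ireg 0, s'.iarr 2 p q = leadNum (s.rarr 2) (s.ireg 2) p q) ∧
        s'.iarr 3 q 0 =
          minUpTo (fun p => leadNum (s.rarr 2) (s.ireg 2) p q) (s.ireg 2) (s.ireg 0)) := by
  refine (Runs.forLoop (B := s.ireg 0 * (s.ireg 2 * 6 + 8) + 4) (N := s.ireg 0)
    (fun k s' => s'.rarr = s.rarr ∧ s'.rreg 0 = 0 ∧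
      (∀ r < 5, s'.ireg r = s.ireg r) ∧ s'.ireg 6 = k ∧
      (∀ q < k, (∀ p < s.ireg 0, s'.iarr 2 p q = leadNum (s.rarr 2) (s.ireg 2) p q) ∧
        s'.iarr 3 q 0 =
          minUpTo (fun p => leadNum (s.rarr 2) (s.ireg 2) p q) (s.ireg 2) (s.ireg 0)))
    ?_ ?_ ?_).weaken le_rfl ?_
  · refine ⟨rfl, h0, ?_, ?_, fun q hq => by omega⟩
    · intro r hr
      simp [State.setI, show r ≠ 6 by omega]
    · simp [State.setI]
  · rintro k s' ⟨-, -, h, h', -⟩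
    exact ⟨h', h 0 (by decide)⟩
  · rintro k hk s' ⟨h₁, h₂, h₃, h₄, h₅⟩
    have f0 := h₃ 0 (by decide)
    have f2 := h₃ 2 (by decide)
    refine (runs_columnProg s' h₂ ((h₃ 4 (by decide)).trans h4)).weaken (by rw [f0, f2]) ?_
    rintro s₁ ⟨e₁, e₂, e₃, e₄, e₅, e₆, e₇⟩
    rw [h₁, f0, f2, h₄] at e₄ e₆
    rw [h₄] at e₅ e₇
    refine ⟨e₁.trans h₁, e₂, ?_, ?_, ?_⟩
    · intro r hr
      rw [← h₃ r hr, ← e₃ r (by omega) (by omega) (by omega) (by omega)]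
      simp [State.setI, show r ≠ 6 by omega]
    · simp only [State.setI, Function.update_self]
      rw [e₃ 6 (by decide) (by decide) (by decide) (by decide), h₄]
    · intro q hq
      simp only [State.setI]
      rcases eq_or_ne q k with rfl | hqk
      · exact ⟨e₄, e₆⟩
      · obtain ⟨a, b⟩ := h₅ q (by omega)
        exact ⟨fun p hp => (e₅ p q hqk).trans (a p hp), (e₇ q hqk).trans b⟩
  · rintro s' ⟨-, -, h₃, -, h₅⟩
    exact ⟨h₃, h₅⟩

/-! ### Searching for a violation of the criterion -/

open Classical in
/-- From `s` to `s'` only the registers in `R` and the flag in register `3` may have changed; the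
flag has been cleared if `P` holds. -/
def Flagged (R : Finset ℕ) (P : Prop) (s s' : State) : Prop :=
  s'.iarr = s.iarr ∧ (∀ r ∉ R, r ≠ 3 → s'.ireg r = s.ireg r) ∧
    s'.ireg 3 = if P then 0 else s.ireg 3

/-- This rule composes under nesting: the conclusion has the same shape as the assumption on the
body, with an existential quantifier added and the counter `r` joined to the registers that may
change. -/
theorem Runs.flagLoop {r b N B : ℕ} {body : Prog} {s : State} {R R' : Finset ℕ} {P : ℕ → Prop}
    (hN : s.ireg b = N) (hbR : b ∉ R) (hrR : r ∈ R) (hrR' : r ∉ R') (hR : R' ⊆ R) (h3 : r ≠ 3)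
    (hb3 : b ≠ 3)
    (hbody : ∀ k < N, ∀ s', s'.iarr = s.iarr → (∀ r ∉ R, r ≠ 3 → s'.ireg r = s.ireg r) →
      s'.ireg r = k → Runs body s' B (Flagged R' (P k) s')) :
    Runs (RAM.forLoop r b body) s (N * (B + 2) + 2) (Flagged R (∃ k < N, P k) s) := by
  classical
  refine (Runs.forLoop (B := B) (N := N) (fun k s' => Flagged R (∃ l < k, P l) s s' ∧
    s'.ireg r = k) ?_ ?_ ?_).weaken le_rfl fun _ h => h.1
  · refine ⟨⟨rfl, fun r' hr' _ => ?_, ?_⟩, ?_⟩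
    · have : r' ≠ r := fun h => hr' (h ▸ hrR)
      simp [State.setI, this]
    · simp [State.setI, h3.symm]
    · simp [State.setI]
  · rintro k s' ⟨⟨-, h, -⟩, h'⟩
    exact ⟨h', (h b hbR hb3).trans hN⟩
  · rintro k hk s' ⟨⟨h₁, h₂, h₃⟩, h₄⟩
    refine (hbody k hk s' h₁ h₂ h₄).weaken le_rfl ?_
    rintro s₁ ⟨e₁, e₂, e₃⟩
    refine ⟨⟨e₁.trans h₁, fun r' hr' hr3 => ?_, ?_⟩, ?_⟩
    · have : r' ≠ r := fun h => hr' (h ▸ hrR)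
      simp only [State.setI, Function.update_of_ne this]
      exact (e₂ r' (fun h => hr' (hR h)) hr3).trans (h₂ r' hr' hr3)
    · simp only [State.setI, Function.update_of_ne h3.symm, e₃, h₃, Nat.exists_lt_succ_right]
      by_cases hP : P k <;> simp [hP]
    · simp only [State.setI, Function.update_self]
      rw [e₂ r hrR' h3, h₄]

/-- Clears the flag if there are indices with `col j < g i k < m` and `col j < g i j`, where `g` is
in array `2` and `col` is in array `3`. -/
def testProg : Prog :=
  forLoop 6 0 (forLoop 5 0 (forLoop 7 0 (.seq (.op (.loadI 8 2 5 7)) (.seq (.op (.loadI 9 3 6 4))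
    (.seq (.op (.loadI 10 2 5 6)) (.ite (.ltI 9 8) (.ite (.ltI 8 2)
      (.ite (.ltI 9 10) (.op (.constI 3 0)) .skip) .skip) .skip))))))

theorem runs_testProg (s : State) (h4 : s.ireg 4 = 0) :
    Runs testProg s (s.ireg 0 * (s.ireg 0 * (s.ireg 0 * 9 + 4) + 4) + 2)
      (Flagged {5, 6, 7, 8, 9, 10} (∃ j < s.ireg 0, ∃ i < s.ireg 0, ∃ k < s.ireg 0,
        s.iarr 3 j 0 < s.iarr 2 i k ∧ s.iarr 2 i k < s.ireg 2 ∧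
          s.iarr 3 j 0 < s.iarr 2 i j) s) := by
  classical
  refine Runs.flagLoop (R' := {5, 7, 8, 9, 10}) rfl (by decide) (by decide) (by decide)
    (by decide) (by decide) (by decide) fun j hj s₁ a₁ b₁ c₁ => ?_
  refine Runs.flagLoop (R' := {7, 8, 9, 10}) (b₁ 0 (by decide) (by decide)) (by decide)
    (by decide) (by decide) (by decide) (by decide) (by decide) fun i hi s₂ a₂ b₂ c₂ => ?_
  have i₂ : s₂.iarr = s.iarr := a₂.trans a₁
  refine Runs.flagLoop (R' := {8, 9, 10}) ((b₂ 0 (by decide) (by decide)).trans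
    (b₁ 0 (by decide) (by decide))) (by decide) (by decide) (by decide) (by decide) (by decide)
    (by decide) fun k hk s₃ a₃ b₃ c₃ => ?_
  have i₃ : s₃.iarr = s.iarr := a₃.trans i₂
  have f4 : s₃.ireg 4 = 0 := ((b₃ 4 (by decide) (by decide)).trans
    ((b₂ 4 (by decide) (by decide)).trans (b₁ 4 (by decide) (by decide)))).trans h4
  have f2 : s₃.ireg 2 = s.ireg 2 := (b₃ 2 (by decide) (by decide)).trans
    ((b₂ 2 (by decide) (by decide)).trans (b₁ 2 (by decide) (by decide)))
  have f6 : s₃.ireg 6 = j := ((b₃ 6 (by decide) (by decide)).trans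
    (b₂ 6 (by decide) (by decide))).trans c₁
  have f5 : s₃.ireg 5 = i := (b₃ 5 (by decide) (by decide)).trans c₂
  set s₄ := (Op.loadI 10 2 5 6).run ((Op.loadI 9 3 6 4).run ((Op.loadI 8 2 5 7).run s₃)) with hs₄
  have g2 : s₄.ireg 2 = s.ireg 2 := by simp [hs₄, Op.run, State.setI, f2]
  have g8 : s₄.ireg 8 = s.iarr 2 i k := by simp [hs₄, Op.run, State.setI, f5, c₃, i₃]
  have g9 : s₄.ireg 9 = s.iarr 3 j 0 := by simp [hs₄, Op.run, State.setI, f6, f4, i₃]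
  have g10 : s₄.ireg 10 = s.iarr 2 i j := by simp [hs₄, Op.run, State.setI, f5, f6, i₃]
  have gr : ∀ r ∉ ({8, 9, 10} : Finset ℕ), s₄.ireg r = s₃.ireg r := by
    intro r hr
    simp only [Finset.mem_insert, Finset.mem_singleton, not_or] at hr
    simp [hs₄, Op.run, State.setI, hr]
  have hfalse : ∀ {Q : Prop}, ¬ Q → Flagged {8, 9, 10} Q s₃ s₄ := fun hQ =>
    ⟨rfl, fun r hr _ => gr r hr, by rw [if_neg hQ]; exact gr 3 (by decide)⟩
  refine (Runs.seq (Runs.op (Runs.seq (Runs.op (Runs.seq (Runs.op (Runs.ite (B := 3)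
    (fun t₁ => Runs.ite (B := 2) (fun t₂ => Runs.ite (B := 1) (fun t₃ => Runs.op ?_)
    fun t₃ => Runs.skip ?_) fun t₂ => (Runs.skip ?_).weaken (by omega) fun _ h => h)
    fun t₁ => (Runs.skip ?_).weaken (by omega) fun _ h => h)))))))
  · change s₄.ireg 9 < s₄.ireg 8 at t₁
    change s₄.ireg 8 < s₄.ireg 2 at t₂
    change s₄.ireg 9 < s₄.ireg 10 at t₃
    rw [g8, g9] at t₁
    rw [g8, g2] at t₂
    rw [g9, g10] at t₃
    refine ⟨rfl, fun r hr h3 => ?_, ?_⟩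
    · change ((Op.constI 3 0).run s₄).ireg r = _
      rw [← gr r hr]
      simp [Op.run, State.setI, h3]
    · rw [if_pos ⟨t₁, t₂, t₃⟩]
      change ((Op.constI 3 0).run s₄).ireg 3 = _
      simp [Op.run, State.setI]
  · refine hfalse fun h => t₃ ?_
    change s₄.ireg 9 < s₄.ireg 10
    rw [g9, g10]
    exact h.2.2
  · refine hfalse fun h => t₂ ?_
    change s₄.ireg 8 < s₄.ireg 2
    rw [g8, g2]
    exact h.2.1
  · refine hfalse fun h => t₁ ?_
    change s₄.ireg 9 < s₄.ireg 8
    rw [g8, g9]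
    exact h.1

/-- Decides orbit periodicity. -/
def orbitProg : Prog :=
  .seq tableProg (.seq (.op (.constI 3 1)) (.seq testProg (.op (.copyI 0 3))))

theorem time_le {n m : ℕ} (hmn : m ≤ n) (hn1 : 1 ≤ n) :
    n * (n * (m * 6 + 8) + 6) + 2 + (1 + (n * (n * (n * 9 + 4) + 4) + 2 + 1)) ≤ 50 * n ^ 3 := by
  -- After `m` is replaced by `n` the left side is `15 n³ + 12 n² + 10 n + 6`, so the constant `50`
  -- is generous.
  have i₁ : n * n * m ≤ n * n * n := Nat.mul_le_mul_left _ hmn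
  have i₂ : n * n ≤ n * n * n := Nat.le_mul_of_pos_right _ hn1
  have i₃ : n ≤ n * n := Nat.le_mul_of_pos_right _ hn1
  ring_nf at i₁ i₂ i₃ ⊢
  omega

open Classical in
theorem runs_orbitProg (s : State) (h0 : s.rreg 0 = 0) (h4 : s.ireg 4 = 0) {n m : ℕ}
    (hn : s.ireg 0 = n) (hm : s.ireg 2 = m) (hmn : m ≤ n) (hn1 : 1 ≤ n) :
    Runs orbitProg s (50 * n ^ 3) fun s' => s'.ireg 0 =
      if ∃ j < n, ∃ i < n, ∃ k < n,
        minUpTo (fun p => leadNum (s.rarr 2) m p j) m n < leadNum (s.rarr 2) m i k ∧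
        leadNum (s.rarr 2) m i k < m ∧
        minUpTo (fun p => leadNum (s.rarr 2) m p j) m n < leadNum (s.rarr 2) m i j
      then 0 else 1 := by
  subst hn hm
  set n := s.ireg 0 with hn
  set m := s.ireg 2 with hm
  refine (Runs.seq (B' := 1 + (n * (n * (n * 9 + 4) + 4) + 2 + 1))
    ((runs_tableProg s h0 h4).weaken le_rfl ?_)).weaken ?_ fun _ h => h
  · rintro s₁ ⟨h₁, h₂⟩
    set s₂ := (Op.constI 3 1).run s₁ with hs₂
    have r2 : s₂.iarr = s₁.iarr := rfl
    have e0 : s₂.ireg 0 = n := by simp [hs₂, Op.run, State.setI, h₁ 0, hn]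
    have e2 : s₂.ireg 2 = m := by simp [hs₂, Op.run, State.setI, h₁ 2, hm]
    have e3 : s₂.ireg 3 = 1 := by simp [hs₂, Op.run, State.setI]
    have e4 : s₂.ireg 4 = 0 := by simp [hs₂, Op.run, State.setI, h₁ 4, h4]
    refine Runs.seq (Runs.op (Runs.seq ((runs_testProg s₂ e4).weaken (by rw [e0]) ?_)))
    rintro s₃ ⟨-, -, h₃⟩
    refine Runs.op ?_
    simp only [Op.run, State.setI, Function.update_self]
    rw [h₃, e3, e0, e2, r2]
    have hiff : (∃ j < n, ∃ i < n, ∃ k < n, s₁.iarr 3 j 0 < s₁.iarr 2 i k ∧ s₁.iarr 2 i k < m ∧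
        s₁.iarr 3 j 0 < s₁.iarr 2 i j) ↔ _ :=
      exists_congr fun j => and_congr_right fun hj => exists_congr fun i =>
        and_congr_right fun hi => exists_congr fun k => and_congr_right fun hk => by
          rw [(h₂ j hj).2, (h₂ k hk).1 i hi, (h₂ j hj).1 i hi]
    split_ifs with t₁ t₂ t₂
    · rfl
    · exact absurd (hiff.1 t₁) t₂
    · exact absurd (hiff.2 t₂) t₁
    · rfl
  · exact time_le hmn hn1

end RAM

/-! ### Correctness of the program -/

namespace MaxAlg

theorem leadNum_input {n c : ℕ} (A : Mat n) (comp : Fin n → Fin c) (i j : Fin n) :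
    RAM.leadNum ((input A comp).rarr 2) (ultCount A) i j = lead A i j 1 := by
  have hu : ∀ ν < ultCount A, (input A comp).rarr 2 ν i j = ultU A ν 1 i j := fun ν hν => by
    simp [input, hν]
  refine eq_of_forall_lt_iff fun x => not_iff_not.1 ?_
  rw [not_lt, not_lt, ← Nat.lt_succ_iff, ← Nat.lt_succ_iff, RAM.leadNum, RAM.minUpTo_lt_iff,
    lead_one_eq, csInf_lt_iff (OrderBot.bddBelow _) ⟨ultCount A, Or.inl le_rfl⟩]
  constructor
  · rintro (h | ⟨ν, hν, h⟩)
    · exact ⟨_, Or.inl le_rfl, h⟩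
    · split_ifs at h with h0
      · exact ⟨_, Or.inl le_rfl, h⟩
      · exact ⟨ν, Or.inr (by rwa [hu ν hν] at h0), h⟩
  · rintro ⟨ν, hν, h⟩
    rcases le_or_gt (ultCount A) ν with hc | hc
    · exact Or.inl (hc.trans_lt h)
    · refine Or.inr ⟨ν, hc, ?_⟩
      rw [hu ν hc, if_neg (hν.resolve_left (not_le.2 hc))]
      exact h

/-- The row `i'` of the criterion occurs only in upper bounds on its entry in column `j`, so a
suitable row exists exactly when the column minimum satisfies them. This removes one of four nested
loops. -/
theorem orbitPeriodic_iff_leadNum {n c : ℕ} (A : Mat n) (comp : Fin n → Fin c) :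
    OrbitPeriodic A ↔ ¬ ∃ j < n, ∃ i < n, ∃ k < n,
      RAM.minUpTo (fun p => RAM.leadNum ((input A comp).rarr 2) (ultCount A) p j) (ultCount A) n <
        RAM.leadNum ((input A comp).rarr 2) (ultCount A) i k ∧
      RAM.leadNum ((input A comp).rarr 2) (ultCount A) i k < ultCount A ∧
      RAM.minUpTo (fun p => RAM.leadNum ((input A comp).rarr 2) (ultCount A) p j) (ultCount A) n <
        RAM.leadNum ((input A comp).rarr 2) (ultCount A) i j := by
  rw [orbitPeriodic_iff]
  simp only [← leadNum_input A comp]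
  set g := RAM.leadNum ((input A comp).rarr 2) (ultCount A) with hg
  constructor
  · rintro H ⟨j, hj, i, hi, k, hk, h₁, h₂, h₃⟩
    rcases (RAM.minUpTo_lt_iff (fun p => g p j) _ _ _).1 (lt_min h₁ h₃) with h | ⟨p, hp, h⟩
    -- The starting value `ultCount A` of the column minimum is not a witness, since the entry at
    -- `(i, k)` lies below it.
    · exact absurd (h.trans_le (min_le_left _ _)) (not_lt.2 h₂.le)
    · have := H ⟨i, hi⟩ ⟨p, hp⟩ ⟨j, hj⟩ ⟨k, hk⟩ (h.trans_le (min_le_left _ _)) h₂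
      exact absurd (h.trans_le (min_le_right _ _)) (not_lt.2 this)
  · intro H i i' j k h₁ h₂
    by_contra! h₃
    exact H ⟨j, j.2, i, i.2, k, k.2,
      (RAM.minUpTo_lt_iff (fun p => g p j) _ _ _).2 (Or.inr ⟨i', i'.2, h₁⟩), h₂,
      (RAM.minUpTo_lt_iff (fun p => g p j) _ _ _).2 (Or.inr ⟨i', i'.2, h₃⟩)⟩

end MaxAlg

theorem theorem7p6 :
    ∃ (P : RAM.Prog) (κ : ℕ), ∀ (n : ℕ), 1 ≤ n →
      ∀ (A : MaxAlg.Mat n) (c : ℕ) (comp : Fin n → Fin c), MaxAlg.IsComponentNumbering A comp →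
        ∃ (s : RAM.State) (T : ℕ), RAM.Exec P (MaxAlg.input A comp) s T ∧ T ≤ κ * n ^ 3 ∧
          (MaxAlg.OrbitPeriodic A → s.ireg 0 = 1) ∧
          (¬ MaxAlg.OrbitPeriodic A → s.ireg 0 = 0) := by
  refine ⟨RAM.orbitProg, 50, fun n hn A c comp _ => ?_⟩
  obtain ⟨s, T, hE, hT, hs⟩ := RAM.runs_orbitProg (MaxAlg.input A comp) rfl
    (by simp [MaxAlg.input]) (n := n) (m := MaxAlg.ultCount A) (by simp [MaxAlg.input])
    (by simp [MaxAlg.input]) (MaxAlg.ultCount_le A) hn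
  refine ⟨s, T, hE, hT, fun h => ?_, fun h => ?_⟩
  · rw [hs, if_neg ((MaxAlg.orbitPeriodic_iff_leadNum A comp).1 h)]
  · rw [hs, if_pos (not_not.1 fun h' => h ((MaxAlg.orbitPeriodic_iff_leadNum A comp).2 h'))]
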